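/- Let $n\ge 2$ be an integer and consider the system $$\frac{dR}{dZ}=-\tan\theta+\frac{R}{2Z},\qquad \frac{d\theta}{dZ}=(n-1)\Bigl(\frac1{\cos\theta}-\frac1R\Bigr),\qquad Z>0,\ R>0,\ \theta\in\Bigl(-\frac\pi2,\frac\pi2\Bigr).\tag{S}$$ A \emph{formal solution} of (S) is a pair of formal series $\sum_{k\ge0}R_k/Z^k$ and $\sum_{k\ge0}\theta_k/Z^k$ with real coefficients, $R_0>0$ and $-\pi/2<\theta_0<\pi/2$, such that, when they are substituted for $R$ and $\theta$ in (S), with term-by-term differentiation in $Z$ and with $\tan\theta$ and $\cos\theta$ replaced by their Taylor expansions (in powers of $\theta-\theta_0$), both equations hold at every order in $Z^{-1}$. The system (S) has exactly one formal solution; let $(R_k)_{k\ge0}$, $(\theta_k)_{k\ge0}$ be its coefficients. Then for every solution $Z\mapsto(\tilde R(Z),\tilde\theta(Z))$ of (S) that is defined on $(0,+\infty)$, and for every integer $k\ge0$, as $Z\to+\infty$, $$\tilde R(Z)=\sum_{j=0}^k\frac{R_j}{Z^j}+o\Bigl(\frac1{Z^k}\Bigr),\qquad \tilde\theta(Z)=\sum_{j=0}^k\frac{\theta_j}{Z^j}+o\Bigl(\frac1{Z^k}\Bigr).$$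 -/

import Mathlib

open Filter Asymptotics
open scoped Nat PowerSeries Topology

noncomputable section

namespace Capillary

/-- `(R, θ)` is a solution, defined on `(0, +∞)`, of the rescaled capillary system
`dR/dZ = - tan θ + R / (2 Z)`, `dθ/dZ = (n - 1) (1 / cos θ - 1 / R)`,
where `R > 0` and `θ ∈ (-π/2, π/2)`. The values for `Z ≤ 0` play no role. -/
structure IsSolution (n : ℕ) (R θ : ℝ → ℝ) : Prop where
  R_pos : ∀ Z : ℝ, 0 < Z → 0 < R Z
  θ_mem : ∀ Z : ℝ, 0 < Z → θ Z ∈ Set.Ioo (-(Real.pi / 2)) (Real.pi / 2)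
  deriv_R : ∀ Z : ℝ, 0 < Z → HasDerivAt R (-Real.tan (θ Z) + R Z / (2 * Z)) Z
  deriv_θ : ∀ Z : ℝ, 0 < Z →
    HasDerivAt θ (((n : ℝ) - 1) * (1 / Real.cos (θ Z) - 1 / R Z)) Z

/-- The Taylor series `∑ m, f⁽ᵐ⁾(a) / m! * X ^ m` of `f` at `a`. -/
def taylorSeries (f : ℝ → ℝ) (a : ℝ) : ℝ⟦X⟧ :=
  PowerSeries.mk fun m => iteratedDeriv m f a / (m ! : ℝ)

/-- The formal composition `f(p)`: with `a` the constant term of `p`, the series `p - a` (which has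
no constant term) is substituted into the Taylor series of `f` at `a`. -/
def formalComp (f : ℝ → ℝ) (p : ℝ⟦X⟧) : ℝ⟦X⟧ :=
  (taylorSeries f (PowerSeries.constantCoeff p)).subst
    (p - PowerSeries.C (PowerSeries.constantCoeff p))

/-- A series `p` in the variable `X = 1 / Z` stands for `∑ k, pₖ / Z ^ k`; its term by term
derivative with respect to `Z` is `∑ k, - k pₖ / Z ^ (k + 1)`, that is `- X² dp/dX`. -/
def derivZ (p : ℝ⟦X⟧) : ℝ⟦X⟧ :=
  -(PowerSeries.X ^ 2 * PowerSeries.derivative ℝ p)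

/-- The formal expansions `R = ∑ k, Rₖ / Z ^ k` and `θ = ∑ k, θₖ / Z ^ k`, encoded as power series
in `X = 1 / Z`, form a formal solution of the rescaled capillary system: `R₀ > 0`,
`-π/2 < θ₀ < π/2`, and both equations hold at every order in `1 / Z`. -/
structure IsFormalSolution (n : ℕ) (R θ : ℝ⟦X⟧) : Prop where
  R_pos : 0 < PowerSeries.constantCoeff R
  θ_mem : PowerSeries.constantCoeff θ ∈ Set.Ioo (-(Real.pi / 2)) (Real.pi / 2)
  eq_R : derivZ R =
    -formalComp Real.tan θ + PowerSeries.C (1 / 2 : ℝ) * PowerSeries.X * R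
  eq_θ : derivZ θ =
    PowerSeries.C ((n : ℝ) - 1) * ((formalComp Real.cos θ)⁻¹ - R⁻¹)

end Capillary

end

open Filter Asymptotics
open scoped Nat PowerSeries Topology

noncomputable section

namespace Capillary

open PowerSeries

/-! ### Formal solutions: an X-adic contraction. -/

section Formal

/-! Formal side. The constant terms must be R₀ = 1, θ₀ = 0. Solving the second equation for R, and
the first for the linear part of tan θ, turns the system into a fixed point problem for
`formalStep`. All that remains on the right gains one power of X = 1/Z (`formalStep_agree`), so
there is exactly one fixed point.

Convergence to (1, 0). Without the term R/(2Z) the system has the first integral E = R^(n-1) cos θ -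
(n-1)/n R^n, with maximum 1/n at R = 1, θ = 0. Along a global solution E stays positive
(`energy_pos`): otherwise θ' ≥ 1/2 from some time on and θ leaves its interval. Hence R ≤ 2. Adding
R^n sin θ/(2Z) to E gives a flux that decreases up to an integrable error, with dissipation of size
1/Z. If E stayed away from 1/n, this dissipation would accumulate like log Z, against E > 0
(`exists_energy_gt`). So E comes arbitrarily close to 1/n at late times, and near monotonicity of
the flux carries this bound back to every earlier time (`tendsto_energy`).

Rate. In the coordinates x = (R^n/n, sin θ) the system reads x' = J(∇V + Sx/Z) + (ℓ/Z) x with ℓ =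
n/4 > 0, where V = -E has a nondegenerate minimum. Let a be a truncation of the formal solution and
y = x - a. The Hamiltonian part leaves a Bregman divergence D ≍ |y|² nearly unchanged and the
dilation makes it grow: D' ≥ α|y|²/Z - β|y|Z^(-m-2). As D → 0 at infinity, integrating back from
infinity gives D = O(Z^(-2m-2)), that is, y = O(Z^(-m-1)) (`sub_isBigO_of_perturbed_hamiltonian`).
-/

theorem X_pow_dvd_subst_sub_sum {q : ℝ⟦X⟧} (hq : X ∣ q) (F : ℝ⟦X⟧) (N : ℕ) :
    X ^ N ∣ F.subst q - ∑ m ∈ Finset.range N, C (coeff m F) * q ^ m := by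
  have hs : HasSubst q := HasSubst.of_constantCoeff_zero' (X_dvd_iff.1 hq)
  have hF := eq_X_pow_mul_shift_add_trunc N F
  have h1 : F.subst q = q ^ N * (PowerSeries.mk fun i => coeff (i + N) F).subst q
      + ((trunc N F : Polynomial ℝ) : ℝ⟦X⟧).subst q := by
    conv_lhs => rw [hF]
    rw [subst_add hs, subst_mul hs, subst_pow hs, subst_X hs]
  have h2 : ((trunc N F : Polynomial ℝ) : ℝ⟦X⟧).subst q
      = ∑ m ∈ Finset.range N, C (coeff m F) * q ^ m := by
    rw [subst_coe hs, Polynomial.aeval_def, eval₂_trunc_eq_sum_range]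
    rfl
  rw [h1, h2, add_sub_cancel_right]
  exact Dvd.dvd.mul_right (pow_dvd_pow_of_dvd hq N) _

/-- For m ≥ 2 the factor of q - q' in q^m - q'^m is itself divisible by X, so only the linear term
of F acts at order k. -/
theorem X_pow_dvd_subst_sub_subst {q q' : ℝ⟦X⟧} (hq : X ∣ q) (hq' : X ∣ q') (F : ℝ⟦X⟧) {k : ℕ}
    (h : X ^ k ∣ q - q') :
    X ^ (k + 1) ∣ F.subst q - F.subst q' - C (coeff 1 F) * (q - q') := by
  have h1 := X_pow_dvd_subst_sub_sum hq F (k + 2)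
  have h2 := X_pow_dvd_subst_sub_sum hq' F (k + 2)
  have h3 : X ^ (k + 1) ∣ (∑ m ∈ Finset.range (k + 2), C (coeff m F) * q ^ m)
      - (∑ m ∈ Finset.range (k + 2), C (coeff m F) * q' ^ m) - C (coeff 1 F) * (q - q') := by
    have e : (∑ m ∈ Finset.range (k + 2), C (coeff m F) * q ^ m)
      - (∑ m ∈ Finset.range (k + 2), C (coeff m F) * q' ^ m) - C (coeff 1 F) * (q - q')
      = ∑ m ∈ Finset.range k, C (coeff (m + 2) F) * (q ^ (m + 2) - q' ^ (m + 2)) := by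
      rw [← Finset.sum_sub_distrib, Finset.sum_range_succ', Finset.sum_range_succ']
      simp only [mul_sub]
      simp
    rw [e]
    refine Finset.dvd_sum fun m _ => Dvd.dvd.mul_left ?_ _
    rw [← Commute.geom_sum₂_mul (Commute.all q q'), mul_comm, pow_succ]
    refine mul_dvd_mul h (Finset.dvd_sum fun i hi => ?_)
    rcases Nat.eq_zero_or_pos i with rfl | hi'
    · exact Dvd.dvd.mul_left (dvd_pow hq' (by simp)) _
    · exact Dvd.dvd.mul_right (dvd_pow hq (by omega)) _
  have h4 := (h3.add (dvd_trans (pow_dvd_pow X (by omega)) h1)).sub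
    (dvd_trans (pow_dvd_pow X (show k + 1 ≤ k + 2 by omega)) h2)
  convert h4 using 1
  ring

theorem X_pow_dvd_inv_sub_inv {p q : ℝ⟦X⟧} (hp : constantCoeff p ≠ 0) (hq : constantCoeff q ≠ 0)
    {k : ℕ} (h : X ^ k ∣ p - q) : X ^ k ∣ p⁻¹ - q⁻¹ := by
  have e : p⁻¹ - q⁻¹ = -(p⁻¹ * q⁻¹) * (p - q) := by
    linear_combination (q⁻¹) * PowerSeries.mul_inv_cancel p hp
      - p⁻¹ * PowerSeries.mul_inv_cancel q hq
  rw [e]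
  exact Dvd.dvd.mul_left h _

theorem X_pow_dvd_X_sq_mul_derivative {p : ℝ⟦X⟧} {k : ℕ} (h : X ^ k ∣ p) :
    X ^ (k + 1) ∣ X ^ 2 * derivative ℝ p := by
  obtain ⟨r, rfl⟩ := h
  refine ⟨C (k : ℝ) * r + X * derivative ℝ r, ?_⟩
  rw [Derivation.leibniz, Derivation.leibniz_pow]
  simp only [smul_eq_mul, nsmul_eq_mul, derivative_X, map_natCast]
  rcases k with _ | k
  · simp; ring
  · simp only [Nat.add_sub_cancel]; ring

theorem eq_of_forall_X_pow_dvd_sub {p q : ℝ⟦X⟧} (h : ∀ k : ℕ, X ^ k ∣ p - q) : p = q := by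
  ext k
  have := X_pow_dvd_iff.1 (h (k + 1)) k (Nat.lt_succ_self k)
  rw [map_sub] at this
  linarith

/-- `p` and `q` agree below order `k`. -/
def AgreeUpTo (k : ℕ) (p q : ℝ⟦X⟧ × ℝ⟦X⟧) : Prop :=
  X ^ k ∣ p.1 - q.1 ∧ X ^ k ∣ p.2 - q.2

theorem AgreeUpTo.trans {k : ℕ} {p q r : ℝ⟦X⟧ × ℝ⟦X⟧} (h : AgreeUpTo k p q)
    (h' : AgreeUpTo k q r) : AgreeUpTo k p r := by
  constructor
  · have := h.1.add h'.1
    rwa [sub_add_sub_cancel] at this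
  · have := h.2.add h'.2
    rwa [sub_add_sub_cancel] at this

theorem AgreeUpTo.symm {k : ℕ} {p q : ℝ⟦X⟧ × ℝ⟦X⟧} (h : AgreeUpTo k p q) : AgreeUpTo k q p :=
  ⟨(dvd_sub_comm).1 h.1, (dvd_sub_comm).1 h.2⟩

theorem AgreeUpTo.mono {k l : ℕ} (hkl : l ≤ k) {p q : ℝ⟦X⟧ × ℝ⟦X⟧} (h : AgreeUpTo k p q) :
    AgreeUpTo l p q :=
  ⟨dvd_trans (pow_dvd_pow X hkl) h.1, dvd_trans (pow_dvd_pow X hkl) h.2⟩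

theorem eq_of_agreeUpTo {p q : ℝ⟦X⟧ × ℝ⟦X⟧} (h : ∀ k, AgreeUpTo k p q) : p = q :=
  Prod.ext (eq_of_forall_X_pow_dvd_sub fun k => (h k).1)
    (eq_of_forall_X_pow_dvd_sub fun k => (h k).2)

/-- A map that increases the order of agreement has a unique fixed point. -/
theorem existsUnique_fixedPoint (S : Set (ℝ⟦X⟧ × ℝ⟦X⟧)) (hS0 : (0 : ℝ⟦X⟧ × ℝ⟦X⟧) ∈ S)
    (hSc : ∀ p q, AgreeUpTo 1 p q → p ∈ S → q ∈ S)
    (Φ : ℝ⟦X⟧ × ℝ⟦X⟧ → ℝ⟦X⟧ × ℝ⟦X⟧) (hΦS : ∀ p ∈ S, Φ p ∈ S)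
    (hΦ : ∀ p ∈ S, ∀ q ∈ S, ∀ k, AgreeUpTo k p q → AgreeUpTo (k + 1) (Φ p) (Φ q)) :
    ∃! p, p ∈ S ∧ Φ p = p := by
  set s : ℕ → ℝ⟦X⟧ × ℝ⟦X⟧ := fun m => Φ^[m] 0 with hs
  have hs1 : ∀ m, s (m + 1) = Φ (s m) := fun m => Function.iterate_succ_apply' Φ m 0
  have hsS : ∀ m, s m ∈ S := by
    intro m
    induction m with
    | zero => exact hS0
    | succ m ih => rw [hs1]; exact hΦS _ ih
  have hstep : ∀ m, AgreeUpTo m (s m) (s (m + 1)) := by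
    intro m
    induction m with
    | zero => exact ⟨by simp, by simp⟩
    | succ m ih =>
      rw [hs1 (m + 1)]
      nth_rewrite 1 [hs1 m]
      exact hΦ _ (hsS _) _ (hsS _) _ ih
  have hle : ∀ m j, AgreeUpTo m (s m) (s (m + j)) := by
    intro m j
    induction j with
    | zero => exact ⟨by simp, by simp⟩
    | succ j ih => exact ih.trans ((hstep (m + j)).mono (by omega))
  -- The coefficient of index k no longer changes from the iterate k + 1 on, so the diagonal is the
  -- X-adic limit.
  set L : ℝ⟦X⟧ × ℝ⟦X⟧ := (PowerSeries.mk fun k => coeff k (s (k + 1)).1,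
    PowerSeries.mk fun k => coeff k (s (k + 1)).2) with hL
  have hLs : ∀ m, AgreeUpTo m L (s m) := by
    intro m
    constructor
    · rw [X_pow_dvd_iff]
      intro k hk
      have h := (hle (k + 1) (m - (k + 1))).1
      rw [show k + 1 + (m - (k + 1)) = m by omega, X_pow_dvd_iff] at h
      have h1 := h k (Nat.lt_succ_self k)
      simpa [hL] using h1
    · rw [X_pow_dvd_iff]
      intro k hk
      have h := (hle (k + 1) (m - (k + 1))).2
      rw [show k + 1 + (m - (k + 1)) = m by omega, X_pow_dvd_iff] at h
      have h1 := h k (Nat.lt_succ_self k)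
      simpa [hL] using h1
  have hLS : L ∈ S := hSc _ _ (hLs 1).symm (hsS 1)
  refine ⟨L, ⟨hLS, ?_⟩, ?_⟩
  · refine eq_of_agreeUpTo fun k => ?_
    have h1 := hΦ _ hLS _ (hsS k) k (hLs k)
    rw [← hs1] at h1
    exact (h1.trans (hLs (k + 1)).symm).mono (Nat.le_succ k)
  · rintro p ⟨hpS, hp⟩
    refine eq_of_agreeUpTo fun k => ?_
    induction k with
    | zero => exact ⟨by simp, by simp⟩
    | succ k ih =>
      have h1 := hΦ _ hpS _ (hsS k) k (ih.trans (hLs k))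
      rw [← hs1, hp] at h1
      exact h1.trans (hLs (k + 1)).symm

theorem constantCoeff_formalComp (f : ℝ → ℝ) (p : ℝ⟦X⟧) :
    constantCoeff (formalComp f p) = f (constantCoeff p) := by
  have hq : X ∣ p - C (constantCoeff p) := by rw [X_dvd_iff]; simp
  have h := X_pow_dvd_subst_sub_sum hq (taylorSeries f (constantCoeff p)) 1
  rw [pow_one, X_dvd_iff] at h
  simp [taylorSeries] at h
  unfold formalComp taylorSeries
  linarith

theorem X_pow_dvd_formalComp_sub {p q : ℝ⟦X⟧} (hp : X ∣ p) (hq : X ∣ q) (f : ℝ → ℝ) {k : ℕ}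
    (h : X ^ k ∣ p - q) :
    X ^ (k + 1) ∣ formalComp f p - formalComp f q - C (deriv f 0) * (p - q) := by
  have hp0 := X_dvd_iff.1 hp
  have hq0 := X_dvd_iff.1 hq
  have := X_pow_dvd_subst_sub_subst hp hq (taylorSeries f 0) h
  simpa [formalComp, hp0, hq0, taylorSeries] using this

/-- The map whose fixed points are the formal solutions. -/
def formalStep (n : ℕ) (p : ℝ⟦X⟧ × ℝ⟦X⟧) : ℝ⟦X⟧ × ℝ⟦X⟧ :=
  (((formalComp Real.cos p.2)⁻¹ + C (((n : ℝ) - 1)⁻¹) * (X ^ 2 * derivative ℝ p.2))⁻¹,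
    p.2 - formalComp Real.tan p.2 + C (1 / 2 : ℝ) * X * p.1 + X ^ 2 * derivative ℝ p.1)

/-- Each term gains one order: cos has derivative 0 at 0, θ - tan θ has no linear part, and both
multiplication by X and the operator X² d/dX raise the order by one. -/
theorem formalStep_agree (n : ℕ) {p q : ℝ⟦X⟧ × ℝ⟦X⟧} (hp : X ∣ p.2) (hq : X ∣ q.2) {k : ℕ}
    (h : AgreeUpTo k p q) : AgreeUpTo (k + 1) (formalStep n p) (formalStep n q) := by
  have hcp : constantCoeff (formalComp Real.cos p.2) = 1 := by
    rw [constantCoeff_formalComp, X_dvd_iff.1 hp, Real.cos_zero]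
  have hcq : constantCoeff (formalComp Real.cos q.2) = 1 := by
    rw [constantCoeff_formalComp, X_dvd_iff.1 hq, Real.cos_zero]
  have hcos : X ^ (k + 1) ∣ formalComp Real.cos p.2 - formalComp Real.cos q.2 := by
    simpa using X_pow_dvd_formalComp_sub hp hq Real.cos h.2
  have htan : X ^ (k + 1) ∣ formalComp Real.tan p.2 - formalComp Real.tan q.2 - (p.2 - q.2) := by
    have := X_pow_dvd_formalComp_sub hp hq Real.tan h.2
    simpa [Real.deriv_tan] using this
  have hd1 := X_pow_dvd_X_sq_mul_derivative h.1
  have hd2 := X_pow_dvd_X_sq_mul_derivative h.2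
  constructor
  · refine X_pow_dvd_inv_sub_inv (by simp [hcp]) (by simp [hcq]) ?_
    have h1 := X_pow_dvd_inv_sub_inv (by simp [hcp]) (by simp [hcq]) hcos
    have h2 := h1.add (hd2.mul_left (C (((n : ℝ) - 1)⁻¹)))
    convert h2 using 1
    rw [map_sub]
    ring
  · have h1 : X ^ (k + 1) ∣ X * (p.1 - q.1) := by
      rw [pow_succ']
      exact mul_dvd_mul_left _ h.1
    have h2 := ((h1.mul_left (C (1 / 2 : ℝ))).add hd1).sub htan
    convert h2 using 1
    simp only [formalStep, map_sub]
    ring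

theorem IsFormalSolution.constantCoeff_θ {n : ℕ} {R θ : ℝ⟦X⟧} (h : IsFormalSolution n R θ) :
    constantCoeff θ = 0 := by
  have h1 := congrArg constantCoeff h.eq_R
  simp only [derivZ, map_neg, map_mul, map_pow, constantCoeff_X, map_add,
    constantCoeff_formalComp] at h1
  have h2 : Real.tan (constantCoeff θ) = 0 := by
    simp at h1; linarith
  obtain ⟨h3, h4⟩ := h.θ_mem
  by_contra h0
  rcases lt_or_gt_of_ne h0 with h5 | h5
  · exact (Real.tan_neg_of_neg_of_pi_div_two_lt h5 h3).ne h2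
  · exact (Real.tan_pos_of_pos_of_lt_pi_div_two h5 h4).ne' h2

theorem IsFormalSolution.constantCoeff_R {n : ℕ} (hn : 2 ≤ n) {R θ : ℝ⟦X⟧}
    (h : IsFormalSolution n R θ) : constantCoeff R = 1 := by
  have h1 := congrArg constantCoeff h.eq_θ
  have hn' : (2 : ℝ) ≤ n := by exact_mod_cast hn
  simp only [derivZ, map_neg, map_mul, map_pow, constantCoeff_X, map_sub,
    constantCoeff_formalComp, constantCoeff_inv, h.constantCoeff_θ, Real.cos_zero,
    constantCoeff_C] at h1
  have h2 : ((n : ℝ) - 1) * (1 - (constantCoeff R)⁻¹) = 0 := by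
    simpa using h1.symm
  rcases mul_eq_zero.1 h2 with h3 | h3
  · linarith
  · exact inv_eq_one.1 (by linarith)

/-- No condition on R₀ is needed on the right: with θ₀ = 0, the first component of the fixed point
equation forces R₀ = 1. -/
theorem isFormalSolution_iff {n : ℕ} (hn : 2 ≤ n) (p : ℝ⟦X⟧ × ℝ⟦X⟧) :
    IsFormalSolution n p.1 p.2 ↔ X ∣ p.2 ∧ formalStep n p = p := by
  have hn' : (n : ℝ) - 1 ≠ 0 := by
    have : (2 : ℝ) ≤ n := by exact_mod_cast hn
    linarith
  have hCC : C ((n : ℝ) - 1) * C (((n : ℝ) - 1)⁻¹) = (1 : ℝ⟦X⟧) := by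
    rw [← map_mul, mul_inv_cancel₀ hn', map_one]
  constructor
  · intro h
    have h0 : X ∣ p.2 := X_dvd_iff.2 h.constantCoeff_θ
    refine ⟨h0, Prod.ext ?_ ?_⟩
    · have hR : constantCoeff p.1 ≠ 0 := h.R_pos.ne'
      have hR' : constantCoeff (p.1)⁻¹ ≠ 0 := by simpa using hR
      have e : (formalComp Real.cos p.2)⁻¹ + C (((n : ℝ) - 1)⁻¹) * (X ^ 2 * derivative ℝ p.2)
          = (p.1)⁻¹ := by
        have h1 := h.eq_θ
        rw [derivZ] at h1
        linear_combination (-C (((n : ℝ) - 1)⁻¹)) * h1 +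
          ((formalComp Real.cos p.2)⁻¹ - (p.1)⁻¹) * (-hCC)
      simp only [formalStep]
      rw [e, PowerSeries.inv_eq_iff_mul_eq_one hR']
      exact PowerSeries.mul_inv_cancel _ hR
    · have h1 := h.eq_R
      rw [derivZ] at h1
      simp only [formalStep]
      linear_combination (-1 : ℝ⟦X⟧) * h1
  · rintro ⟨h0, h⟩
    have h0' := X_dvd_iff.1 h0
    have e1 := congrArg Prod.fst h
    have e2 := congrArg Prod.snd h
    simp only [formalStep] at e1 e2
    have hc : constantCoeff ((formalComp Real.cos p.2)⁻¹ +
        C (((n : ℝ) - 1)⁻¹) * (X ^ 2 * derivative ℝ p.2)) = 1 := by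
      simp [constantCoeff_formalComp, h0']
    have hR : constantCoeff p.1 = 1 := by
      rw [← e1, constantCoeff_inv, hc, inv_one]
    refine ⟨by rw [hR]; norm_num, ?_, ?_, ?_⟩
    · rw [h0']
      constructor <;> linarith [Real.pi_pos]
    · rw [derivZ]
      linear_combination (-1 : ℝ⟦X⟧) * e2
    · have e3 : (p.1)⁻¹ = (formalComp Real.cos p.2)⁻¹ +
          C (((n : ℝ) - 1)⁻¹) * (X ^ 2 * derivative ℝ p.2) := by
        rw [PowerSeries.inv_eq_iff_mul_eq_one (by rw [hR]; norm_num)]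
        nth_rewrite 1 [← e1]
        exact PowerSeries.mul_inv_cancel _ (by rw [hc]; norm_num)
      rw [derivZ, e3]
      linear_combination (X ^ 2 * derivative ℝ p.2) * hCC

theorem existsUnique_isFormalSolution {n : ℕ} (hn : 2 ≤ n) :
    ∃! p : ℝ⟦X⟧ × ℝ⟦X⟧, IsFormalSolution n p.1 p.2 := by
  simp only [isFormalSolution_iff hn]
  refine existsUnique_fixedPoint {p | X ∣ p.2} (by simp) ?_ _ ?_ ?_
  · rintro p q ⟨-, h⟩ hp
    rw [pow_one] at h
    exact (dvd_sub_right hp).1 h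
  · intro p hp
    have hp' := X_dvd_iff.1 hp
    simp [formalStep, X_dvd_iff, constantCoeff_formalComp, hp']
  · intro p hp q hq k h
    exact formalStep_agree n hp hq h

end Formal

end Capillary

namespace Capillary

/-! ### Calculus of finite expansions at t = 1/Z → 0. -/

section Expansion

/-- `f` has the expansion `p` at `0` up to an error `O(t ^ N)`. -/
def HasExpansion (f : ℝ → ℝ) (p : ℝ⟦X⟧) (N : ℕ) : Prop :=
  ∃ P : Polynomial ℝ, PowerSeries.X ^ N ∣ (P : ℝ⟦X⟧) - p ∧
    (fun t => f t - P.eval t) =O[𝓝 0] (fun t : ℝ => t ^ N)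

theorem eval_isBigO_pow {P : Polynomial ℝ} {N : ℕ} (h : PowerSeries.X ^ N ∣ (P : ℝ⟦X⟧)) :
    (fun t => P.eval t) =O[𝓝 0] (fun t : ℝ => t ^ N) := by
  have h1 : Polynomial.X ^ N ∣ P := by
    rw [Polynomial.X_pow_dvd_iff]
    intro d hd
    simpa using PowerSeries.X_pow_dvd_iff.1 h d hd
  obtain ⟨Q, rfl⟩ := h1
  have h2 : (fun t => Q.eval t) =O[𝓝 0] (fun _ : ℝ => (1 : ℝ)) :=
    (Q.continuous.tendsto 0).isBigO_one ℝ
  simpa using (isBigO_refl (fun t : ℝ => t ^ N) (𝓝 0)).mul h2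

theorem eval_zero_eq_constantCoeff {P : Polynomial ℝ} {p : ℝ⟦X⟧} {N : ℕ}
    (h : PowerSeries.X ^ (N + 1) ∣ (P : ℝ⟦X⟧) - p) :
    P.eval 0 = PowerSeries.constantCoeff p := by
  have h1 := PowerSeries.X_pow_dvd_iff.1 h 0 (Nat.succ_pos N)
  rw [map_sub, Polynomial.coeff_coe, Polynomial.coeff_zero_eq_eval_zero,
    PowerSeries.coeff_zero_eq_constantCoeff_apply] at h1
  linarith

theorem HasExpansion.polynomial (P : Polynomial ℝ) (N : ℕ) {p : ℝ⟦X⟧}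
    (h : PowerSeries.X ^ N ∣ (P : ℝ⟦X⟧) - p) : HasExpansion (fun t => P.eval t) p N :=
  ⟨P, h, by simpa using isBigO_zero _ _⟩

theorem HasExpansion.isBigO {f : ℝ → ℝ} {p : ℝ⟦X⟧} {N : ℕ} (hf : HasExpansion f p N)
    {P : Polynomial ℝ} (h : PowerSeries.X ^ N ∣ (P : ℝ⟦X⟧) - p) :
    (fun t => f t - P.eval t) =O[𝓝 0] (fun t : ℝ => t ^ N) := by
  obtain ⟨Q, hQ, hfQ⟩ := hf
  have h1 : PowerSeries.X ^ N ∣ ((Q - P : Polynomial ℝ) : ℝ⟦X⟧) := by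
    have := hQ.sub h
    rw [sub_sub_sub_cancel_right] at this
    simpa using this
  have h2 := hfQ.add (eval_isBigO_pow h1)
  refine h2.congr_left fun t => ?_
  simp

theorem HasExpansion.congr {f g : ℝ → ℝ} {p q : ℝ⟦X⟧} {N : ℕ} (hf : HasExpansion f p N)
    (hfg : (fun t => g t - f t) =O[𝓝 0] (fun t : ℝ => t ^ N))
    (hpq : PowerSeries.X ^ N ∣ p - q) : HasExpansion g q N := by
  obtain ⟨P, hP, h⟩ := hf
  refine ⟨P, ?_, ?_⟩
  · have := hP.add hpq
    rwa [sub_add_sub_cancel] at this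
  · exact (hfg.add h).congr_left fun t => by ring

theorem HasExpansion.isBigO_one {f : ℝ → ℝ} {p : ℝ⟦X⟧} {N : ℕ} (hf : HasExpansion f p N) :
    f =O[𝓝 0] (fun _ : ℝ => (1 : ℝ)) := by
  obtain ⟨P, -, h⟩ := hf
  have h1 : (fun t : ℝ => t ^ N) =O[𝓝 0] (fun _ : ℝ => (1 : ℝ)) :=
    ((continuous_pow N).tendsto 0).isBigO_one ℝ
  have h2 : (fun t => P.eval t) =O[𝓝 0] (fun _ : ℝ => (1 : ℝ)) :=
    (P.continuous.tendsto 0).isBigO_one ℝ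
  exact ((h.trans h1).add h2).congr_left fun t => by ring

theorem HasExpansion.add {f g : ℝ → ℝ} {p q : ℝ⟦X⟧} {N : ℕ} (hf : HasExpansion f p N)
    (hg : HasExpansion g q N) : HasExpansion (fun t => f t + g t) (p + q) N := by
  obtain ⟨P, hP, h1⟩ := hf
  obtain ⟨Q, hQ, h2⟩ := hg
  refine ⟨P + Q, ?_, ?_⟩
  · convert hP.add hQ using 1
    rw [Polynomial.coe_add]
    ring
  · exact (h1.add h2).congr_left fun t => by rw [Polynomial.eval_add]; ring

theorem HasExpansion.mul {f g : ℝ → ℝ} {p q : ℝ⟦X⟧} {N : ℕ} (hf : HasExpansion f p N)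
    (hg : HasExpansion g q N) : HasExpansion (fun t => f t * g t) (p * q) N := by
  have hf1 := hf.isBigO_one
  obtain ⟨P, hP, h1⟩ := hf
  obtain ⟨Q, hQ, h2⟩ := hg
  have h3 : (fun t => Q.eval t) =O[𝓝 0] (fun _ : ℝ => (1 : ℝ)) :=
    (Q.continuous.tendsto 0).isBigO_one ℝ
  refine ⟨P * Q, ?_, ?_⟩
  · convert (hP.mul_right (Q : ℝ⟦X⟧)).add (hQ.mul_left p) using 1
    rw [Polynomial.coe_mul]
    ring
  · have h4 := hf1.mul h2
    have h5 := h1.mul h3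
    simp only [one_mul, mul_one] at h4 h5
    replace h4 := h4.add h5
    exact h4.congr_left fun t => by rw [Polynomial.eval_mul]; ring

theorem HasExpansion.const (c : ℝ) (N : ℕ) : HasExpansion (fun _ => c) (PowerSeries.C c) N := by
  simpa using HasExpansion.polynomial (Polynomial.C c) N (p := PowerSeries.C c) (by simp)

theorem HasExpansion.id (N : ℕ) : HasExpansion (fun t => t) PowerSeries.X N := by
  simpa using HasExpansion.polynomial Polynomial.X N (p := PowerSeries.X) (by simp)

theorem HasExpansion.pow {f : ℝ → ℝ} {p : ℝ⟦X⟧} {N : ℕ} (hf : HasExpansion f p N) (m : ℕ) :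
    HasExpansion (fun t => f t ^ m) (p ^ m) N := by
  induction m with
  | zero => simpa using HasExpansion.const 1 N
  | succ m ih => simpa only [pow_succ] using ih.mul hf

theorem HasExpansion.const_mul {f : ℝ → ℝ} {p : ℝ⟦X⟧} {N : ℕ} (c : ℝ) (hf : HasExpansion f p N) :
    HasExpansion (fun t => c * f t) (PowerSeries.C c * p) N :=
  (HasExpansion.const c N).mul hf

theorem HasExpansion.sub {f g : ℝ → ℝ} {p q : ℝ⟦X⟧} {N : ℕ} (hf : HasExpansion f p N)
    (hg : HasExpansion g q N) : HasExpansion (fun t => f t - g t) (p - q) N := by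
  have := hf.add (hg.const_mul (-1))
  simpa [sub_eq_add_neg] using this

theorem HasExpansion.sum {ι : Type*} (s : Finset ι) {f : ι → ℝ → ℝ} {p : ι → ℝ⟦X⟧} {N : ℕ}
    (h : ∀ i ∈ s, HasExpansion (f i) (p i) N) :
    HasExpansion (fun t => ∑ i ∈ s, f i t) (∑ i ∈ s, p i) N := by
  classical
  induction s using Finset.induction_on with
  | empty => simpa using HasExpansion.const 0 N
  | insert i s hi ih =>
    simp only [Finset.sum_insert hi]
    exact (h i (Finset.mem_insert_self i s)).add
      (ih fun j hj => h j (Finset.mem_insert_of_mem hj))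

theorem X_pow_dvd_trunc_sub (p : ℝ⟦X⟧) (N : ℕ) :
    PowerSeries.X ^ N ∣ ((PowerSeries.trunc N p : Polynomial ℝ) : ℝ⟦X⟧) - p := by
  refine ⟨-PowerSeries.mk fun i => PowerSeries.coeff (i + N) p, ?_⟩
  have := PowerSeries.eq_X_pow_mul_shift_add_trunc N p
  linear_combination -this

/-- If P truncates p⁻¹, then f P = 1 + O(t^N); multiplying by the locally bounded f⁻¹ gives the
claim. -/
theorem HasExpansion.inv {f : ℝ → ℝ} {p : ℝ⟦X⟧} {N : ℕ} (hf : HasExpansion f p N)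
    (hp : PowerSeries.constantCoeff p ≠ 0) {c : ℝ} (hc : c ≠ 0) (hfc : Tendsto f (𝓝 0) (𝓝 c)) :
    HasExpansion (fun t => (f t)⁻¹) p⁻¹ N := by
  have hP := X_pow_dvd_trunc_sub p⁻¹ N
  set P := PowerSeries.trunc N p⁻¹
  have h1 := hf.mul (HasExpansion.polynomial P N hP)
  rw [PowerSeries.mul_inv_cancel p hp] at h1
  have h2 := h1.isBigO (P := 1) (by simp)
  have h3 := ((hfc.inv₀ hc).isBigO_one ℝ).mul h2
  refine ⟨P, hP, ?_⟩
  simp only [one_mul] at h3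
  have hne : ∀ᶠ t in 𝓝 0, f t ≠ 0 := hfc.eventually_ne hc
  refine (h3.neg_left).congr' ?_ EventuallyEq.rfl
  filter_upwards [hne] with t ht
  simp
  field_simp
  ring

/-- An order of at least one makes g(t) - a = O(t), so the Taylor remainder of f at a becomes
O(t^(N+1)), and only finitely many powers of g - a remain to be expanded. -/
theorem HasExpansion.comp {f g : ℝ → ℝ} {p : ℝ⟦X⟧} {N : ℕ} (hg : HasExpansion g p (N + 1))
    (hf : AnalyticAt ℝ f (PowerSeries.constantCoeff p)) :
    HasExpansion (fun t => f (g t)) (formalComp f p) (N + 1) := by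
  set a := PowerSeries.constantCoeff p with ha
  have hX : PowerSeries.X ∣ p - PowerSeries.C a := by
    rw [PowerSeries.X_dvd_iff]; simp [ha]
  have h1 : (fun t => g t - a) =O[𝓝 0] (fun t : ℝ => t) := by
    have h := hg
    obtain ⟨P, hP, h⟩ := h
    have h2 : PowerSeries.X ^ 1 ∣ ((P - Polynomial.C a : Polynomial ℝ) : ℝ⟦X⟧) := by
      have h3 := (dvd_trans (pow_dvd_pow PowerSeries.X (Nat.le_add_left 1 N)) hP).add
        (by simpa using hX : PowerSeries.X ^ 1 ∣ p - PowerSeries.C a)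
      rw [sub_add_sub_cancel] at h3
      simpa using h3
    have h4 : (fun t : ℝ => t ^ (N + 1)) =O[𝓝 0] (fun t : ℝ => t) := by
      have h5 : (fun t : ℝ => t ^ N) =O[𝓝 0] (fun _ : ℝ => (1 : ℝ)) :=
        ((continuous_pow N).tendsto 0).isBigO_one ℝ
      simpa [pow_succ] using h5.mul (isBigO_refl (fun t : ℝ => t) (𝓝 0))
    have h5 := (h.trans h4).add ((eval_isBigO_pow h2).trans (by simpa using isBigO_refl _ _))
    refine h5.congr_left fun t => ?_
    simp
  have hlim : Tendsto (fun t => g t - a) (𝓝 0) (𝓝 0) := h1.trans_tendsto tendsto_id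
  have h2 : (fun t => f (g t) - ∑ m ∈ Finset.range (N + 1),
      PowerSeries.coeff m (taylorSeries f a) * (g t - a) ^ m) =O[𝓝 0]
        (fun t : ℝ => t ^ (N + 1)) := by
    have h3 := hf.hasFPowerSeriesAt.isBigO_sub_partialSum_pow (N + 1)
    have h4 := (h3.comp_tendsto hlim).trans
      (show _ =O[𝓝 0] (fun t : ℝ => t ^ (N + 1)) from (h1.norm_left.pow (N + 1)))
    refine h4.congr_left fun t => ?_
    simp [FormalMultilinearSeries.partialSum, taylorSeries, mul_comm]
  have h3 : HasExpansion (fun t => ∑ m ∈ Finset.range (N + 1),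
      PowerSeries.coeff m (taylorSeries f a) * (g t - a) ^ m)
      (∑ m ∈ Finset.range (N + 1), PowerSeries.C (PowerSeries.coeff m (taylorSeries f a)) *
        (p - PowerSeries.C a) ^ m) (N + 1) :=
    HasExpansion.sum _ fun m _ => ((hg.sub (HasExpansion.const a _)).pow m).const_mul _
  refine h3.congr h2 ?_
  rw [dvd_sub_comm]
  exact X_pow_dvd_subst_sub_sum hX _ _

theorem HasExpansion.X_sq_mul_derivative (P : Polynomial ℝ) {p : ℝ⟦X⟧} {N : ℕ}
    (h : PowerSeries.X ^ N ∣ (P : ℝ⟦X⟧) - p) :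
    HasExpansion (fun t => t ^ 2 * P.derivative.eval t)
      (PowerSeries.X ^ 2 * PowerSeries.derivative ℝ p) N := by
  have h1 := X_pow_dvd_X_sq_mul_derivative h
  have h2 := HasExpansion.polynomial (Polynomial.X ^ 2 * Polynomial.derivative P) N
    (p := PowerSeries.X ^ 2 * PowerSeries.derivative ℝ p) (by
      refine dvd_trans (pow_dvd_pow PowerSeries.X (Nat.le_succ N)) ?_
      convert h1 using 1
      simp [PowerSeries.derivative_coe, mul_sub])
  simpa using h2

theorem constantCoeff_formalComp_cos_ne_zero {θ : ℝ⟦X⟧} (h : PowerSeries.constantCoeff θ = 0) :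
    PowerSeries.constantCoeff (formalComp Real.cos θ) ≠ 0 := by
  simp [constantCoeff_formalComp, h]

theorem analyticAt_tan_zero : AnalyticAt ℝ Real.tan 0 := by
  have h : Real.tan = fun x => Real.sin x / Real.cos x := funext Real.tan_eq_sin_div_cos
  rw [h]
  exact Real.analyticAt_sin.div Real.analyticAt_cos (by simp)

/-- The truncations of a formal solution satisfy the system up to `O(t ^ N)`, `t = 1 / Z`. -/
theorem IsFormalSolution.residual_isBigO {n : ℕ} (hn : 2 ≤ n) {Rf θf : ℝ⟦X⟧}
    (h : IsFormalSolution n Rf θf) {N : ℕ} {P Q : Polynomial ℝ}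
    (hP : PowerSeries.X ^ (N + 1) ∣ (P : ℝ⟦X⟧) - Rf)
    (hQ : PowerSeries.X ^ (N + 1) ∣ (Q : ℝ⟦X⟧) - θf) :
    (fun t => -(t ^ 2 * P.derivative.eval t) + Real.tan (Q.eval t) - 1 / 2 * t * P.eval t)
      =O[𝓝 0] (fun t : ℝ => t ^ (N + 1)) ∧
    (fun t => -(t ^ 2 * Q.derivative.eval t) -
      ((n : ℝ) - 1) * ((Real.cos (Q.eval t))⁻¹ - (P.eval t)⁻¹))
      =O[𝓝 0] (fun t : ℝ => t ^ (N + 1)) := by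
  have hθ0 := h.constantCoeff_θ
  have hR0 := h.constantCoeff_R hn
  have hP0 := eval_zero_eq_constantCoeff hP
  have hQ0 := eval_zero_eq_constantCoeff hQ
  rw [hR0] at hP0
  rw [hθ0] at hQ0
  have eP := HasExpansion.polynomial P _ hP
  have eQ := HasExpansion.polynomial Q _ hQ
  have etan := eQ.comp (f := Real.tan) (by rw [hθ0]; exact analyticAt_tan_zero)
  have ecos := eQ.comp (f := Real.cos) Real.analyticAt_cos
  have hct : Tendsto (fun t => Real.cos (Q.eval t)) (𝓝 0) (𝓝 1) := by
    have := (Real.continuous_cos.comp Q.continuous).tendsto 0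
    simpa only [Function.comp_def, hQ0, Real.cos_zero] using this
  have hPt : Tendsto (fun t => P.eval t) (𝓝 0) (𝓝 1) := by
    have := P.continuous.tendsto 0
    simpa [hP0] using this
  have eci := ecos.inv (constantCoeff_formalComp_cos_ne_zero hθ0) one_ne_zero hct
  have ePi := eP.inv (by simp [hR0]) one_ne_zero hPt
  have edP := HasExpansion.X_sq_mul_derivative P hP
  have edQ := HasExpansion.X_sq_mul_derivative Q hQ
  constructor
  · have e := ((edP.const_mul (-1)).add etan).sub
      ((((HasExpansion.id (N + 1)).const_mul (1 / 2)).mul eP))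
    have hz := h.eq_R
    rw [derivZ] at hz
    have e' := e.isBigO (P := 0) (by
      convert dvd_zero _ using 1
      simp only [map_neg, map_one, Polynomial.coe_zero]
      linear_combination -hz)
    exact e'.congr_left fun t => by simp
  · have e := (edQ.const_mul (-1)).sub ((eci.sub ePi).const_mul ((n : ℝ) - 1))
    have hz := h.eq_θ
    rw [derivZ] at hz
    have e' := e.isBigO (P := 0) (by
      convert dvd_zero _ using 1
      simp only [map_neg, map_one, Polynomial.coe_zero]
      linear_combination -hz)
    exact e'.congr_left fun t => by simp

end Expansion

end Capillary

namespace Capillary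

/-! ### Decay estimate for perturbed Hamiltonian systems near a minimum. -/

section Energy

theorem exists_monotoneOn_Ici_of_hasDerivAt {Φ Φ' : ℝ → ℝ}
    (h : ∀ᶠ Z in atTop, HasDerivAt Φ (Φ' Z) Z) (h' : ∀ᶠ Z in atTop, 0 ≤ Φ' Z) :
    ∃ Z₀, MonotoneOn Φ (Set.Ici Z₀) := by
  obtain ⟨Z₀, hZ₀⟩ := eventually_atTop.1 (h.and h')
  refine ⟨Z₀, monotoneOn_of_deriv_nonneg (convex_Ici Z₀)
    (fun Z hZ => (hZ₀ Z hZ).1.continuousAt.continuousWithinAt)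
    (fun Z hZ => (hZ₀ Z (interior_subset hZ)).1.differentiableAt.differentiableWithinAt)
    fun Z hZ => ?_⟩
  rw [(hZ₀ Z (interior_subset hZ)).1.deriv]
  exact (hZ₀ Z (interior_subset hZ)).2

theorem eventually_nonpos_of_deriv_nonneg {Φ Φ' : ℝ → ℝ}
    (h : ∀ᶠ Z in atTop, HasDerivAt Φ (Φ' Z) Z) (h' : ∀ᶠ Z in atTop, 0 ≤ Φ' Z)
    (hlim : Tendsto Φ atTop (𝓝 0)) : ∀ᶠ Z in atTop, Φ Z ≤ 0 := by
  obtain ⟨Z₀, hmono⟩ := exists_monotoneOn_Ici_of_hasDerivAt h h'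
  filter_upwards [eventually_ge_atTop Z₀] with Z hZ
  refine ge_of_tendsto hlim ?_
  filter_upwards [eventually_ge_atTop Z] with W hW
  exact hmono hZ (hZ.trans hW) hW

variable {E : Type*} [NormedAddCommGroup E] [NormedSpace ℝ E]

theorem exists_quadratic_remainder_bound {F : Type*} [NormedAddCommGroup F] [NormedSpace ℝ F]
    {G : E → F} {x₀ : E} (hG : ContDiffAt ℝ 2 G x₀) :
    ∃ C, 0 ≤ C ∧ ∀ᶠ p : E × E in 𝓝 (x₀, x₀),
      ‖G p.1 - G p.2 - fderiv ℝ G p.2 (p.1 - p.2)‖ ≤ C * ‖p.1 - p.2‖ ^ 2 := by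
  have h1 : ContDiffAt ℝ 1 (fderiv ℝ G) x₀ := hG.fderiv_right (by norm_num)
  obtain ⟨K, t, ht, hK⟩ := (h1.hasStrictFDerivAt one_ne_zero).exists_lipschitzOnWith
  have h2 : ∀ᶠ x in 𝓝 x₀, ContDiffAt ℝ 2 G x := hG.eventually (by simp)
  obtain ⟨r, hr, hrt⟩ := Metric.mem_nhds_iff.1 (inter_mem ht h2)
  refine ⟨K, K.2, ?_⟩
  have hb := Metric.ball_mem_nhds x₀ hr
  filter_upwards [prod_mem_nhds hb hb] with p hp
  have hseg : segment ℝ p.2 p.1 ⊆ Metric.ball x₀ r :=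
    (convex_ball x₀ r).segment_subset hp.2 hp.1
  have hbound : ∀ z ∈ segment ℝ p.2 p.1,
      ‖fderiv ℝ G z - fderiv ℝ G p.2‖ ≤ K * ‖p.1 - p.2‖ := fun z hz => by
    refine (hK.norm_sub_le (hrt (hseg hz)).1 (hrt hp.2).1).trans ?_
    gcongr
    exact norm_sub_le_of_mem_segment hz
  have h3 := (convex_segment (𝕜 := ℝ) p.2 p.1).norm_image_sub_le_of_norm_hasFDerivWithin_le'
    (fun z hz => ((show ContDiffAt ℝ 2 G z from (hrt (hseg hz)).2).differentiableAt
      two_ne_zero).hasFDerivAt.hasFDerivWithinAt)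
    hbound (left_mem_segment ℝ _ _) (right_mem_segment ℝ _ _)
  refine h3.trans (le_of_eq ?_)
  ring

/-- Uniform convexity near x₀: after subtracting the quadratic form A/2, the gradient varies by at
most (c/4) times the distance, and the mean value inequality leaves c/2 - c/4. -/
theorem eventually_bregman_ge {V : E → ℝ} {G : E → E →L[ℝ] ℝ} {x₀ : E}
    (hV : ∀ᶠ x in 𝓝 x₀, HasFDerivAt V (G x) x) {A : E →L[ℝ] E →L[ℝ] ℝ}
    (hG : HasStrictFDerivAt G A x₀) (hA : ∀ v w, A v w = A w v) {c : ℝ} (hc : 0 < c)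
    (hpos : ∀ v, c * ‖v‖ ^ 2 ≤ A v v) :
    ∀ᶠ p : E × E in 𝓝 (x₀, x₀),
      c / 4 * ‖p.1 - p.2‖ ^ 2 ≤ V p.1 - V p.2 - G p.2 (p.1 - p.2) := by
  have h1 := hG.isLittleO.def (show 0 < c / 4 by positivity)
  have hV' : ∀ᶠ p : E × E in 𝓝 (x₀, x₀), HasFDerivAt V (G p.1) p.1 :=
    (continuous_fst.tendsto (x₀, x₀)).eventually hV
  obtain ⟨r, hr, hrt⟩ := Metric.eventually_nhds_iff_ball.1 (h1.and hV')
  rw [← ball_prod_same] at hrt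
  have hb := Metric.ball_mem_nhds x₀ hr
  filter_upwards [prod_mem_nhds hb hb] with p hp
  have hseg : segment ℝ p.2 p.1 ⊆ Metric.ball x₀ r :=
    (convex_ball x₀ r).segment_subset hp.2 hp.1
  have hd : ∀ z ∈ segment ℝ p.2 p.1, HasFDerivWithinAt
      (fun z => V z - 1 / 2 * A (z - p.2) (z - p.2)) (G z - A (z - p.2)) (segment ℝ p.2 p.1) z := by
    intro z hz
    have e1 : HasFDerivAt (fun z => z - p.2) (ContinuousLinearMap.id ℝ E) z :=
      (hasFDerivAt_id z).sub_const _
    have e2 : HasFDerivAt (fun z => A (z - p.2)) A z := by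
      exact A.hasFDerivAt.comp z e1
    have e3 := e2.clm_apply e1
    have e4 := ((hrt (z, p.2) ⟨hseg hz, hp.2⟩).2).sub (e3.const_mul (1 / 2 : ℝ))
    refine (e4.congr_fderiv ?_).hasFDerivWithinAt
    ext v
    simp [hA v]
    ring
  have hbound : ∀ z ∈ segment ℝ p.2 p.1,
      ‖G z - A (z - p.2) - G p.2‖ ≤ c / 4 * ‖p.1 - p.2‖ := fun z hz => by
    have e := (hrt (z, p.2) ⟨hseg hz, hp.2⟩).1
    rw [sub_right_comm]
    refine e.trans ?_
    gcongr
    exact norm_sub_le_of_mem_segment hz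
  have h3 := (convex_segment (𝕜 := ℝ) p.2 p.1).norm_image_sub_le_of_norm_hasFDerivWithin_le'
    hd hbound (left_mem_segment ℝ _ _) (right_mem_segment ℝ _ _)
  simp only [sub_self, map_zero, mul_zero, sub_zero] at h3
  have h4 := (abs_le.1 h3).1
  have h5 := hpos (p.1 - p.2)
  nlinarith

/-- The sign ℓ > 0 is decisive: the dilation pushes x away from a, so the only way for x - a to
vanish at infinity is to be as small as the residual, divided by the rate 1/Z, allows. -/
theorem sub_isBigO_of_perturbed_hamiltonian {V : E → ℝ} {G : E → E →L[ℝ] ℝ} {x₀ : E}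
    (hV : ∀ᶠ x in 𝓝 x₀, HasFDerivAt V (G x) x) (hG : ContDiffAt ℝ 2 G x₀) {c : ℝ} (hc : 0 < c)
    (hpos : ∀ v, c * ‖v‖ ^ 2 ≤ fderiv ℝ G x₀ v v)
    {S : E →L[ℝ] E →L[ℝ] ℝ} (hS : ∀ v w, S v w = S w v)
    {J : (E →L[ℝ] ℝ) →ₗ[ℝ] E} (hJ : ∀ f : E →L[ℝ] ℝ, f (J f) = 0) {ℓ : ℝ} (hℓ : 0 < ℓ)
    {x a a' : ℝ → E} (hx₀ : Tendsto x atTop (𝓝 x₀)) (ha₀ : Tendsto a atTop (𝓝 x₀))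
    (hx : ∀ᶠ Z in atTop, HasDerivAt x (J (G (x Z) + Z⁻¹ • S (x Z)) + (ℓ * Z⁻¹) • x Z) Z)
    (ha : ∀ᶠ Z in atTop, HasDerivAt a (a' Z) Z)
    (ha' : a' =O[atTop] fun Z : ℝ => Z⁻¹ ^ 2) {m : ℕ}
    (hρ : (fun Z => a' Z - (J (G (a Z) + Z⁻¹ • S (a Z)) + (ℓ * Z⁻¹) • a Z))
      =O[atTop] fun Z : ℝ => Z⁻¹ ^ (m + 2)) :
    (fun Z => x Z - a Z) =O[atTop] fun Z : ℝ => Z⁻¹ ^ (m + 1) := by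
  have hGs := hG.hasStrictFDerivAt two_ne_zero
  have hGd : ∀ᶠ z in 𝓝 x₀, HasFDerivAt G (fderiv ℝ G z) z := by
    filter_upwards [hG.eventually (by simp)] with z hz
    exact (hz.differentiableAt two_ne_zero).hasFDerivAt
  have hsymm : ∀ᶠ z in 𝓝 x₀, ∀ v w, fderiv ℝ G z v w = fderiv ℝ G z w v := by
    filter_upwards [hV.eventually_nhds, hGd] with z h1 h2 v w
    exact second_derivative_symmetric_of_eventually h1 h2 v w
  set A := fderiv ℝ G x₀ with hA
  obtain ⟨C, hC, hrem⟩ := exists_quadratic_remainder_bound hG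
  have hbreg := eventually_bregman_ge hV hGs hsymm.self_of_nhds hc hpos
  have hlin := hGs.isLittleO.def (show 0 < c / 4 by positivity)
  have hpair : Tendsto (fun Z => (x Z, a Z)) atTop (𝓝 (x₀, x₀)) := hx₀.prodMk_nhds ha₀
  obtain ⟨Ca, hCa0, hCa⟩ := ha'.exists_pos
  obtain ⟨Cρ, hCρ0, hCρ⟩ := hρ.exists_pos
  set y : ℝ → E := fun Z => x Z - a Z with hy
  set ρ : ℝ → E := fun Z => a' Z - (J (G (a Z) + Z⁻¹ • S (a Z)) + (ℓ * Z⁻¹) • a Z) with hρdef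
  set g : ℝ → E →L[ℝ] ℝ := fun Z => G (x Z) - G (a Z) + Z⁻¹ • S (y Z) with hg
  set y' : ℝ → E := fun Z => J (g Z) + (ℓ * Z⁻¹) • y Z - ρ Z with hy'
  have hyd : ∀ᶠ Z in atTop, HasDerivAt y (y' Z) Z := by
    filter_upwards [hx, ha] with Z h1 h2
    refine (h1.sub h2).congr_deriv ?_
    simp only [hy', hg, hρdef, hy, map_add, map_sub, map_smul, smul_sub]
    abel
  -- The last term makes `g` the derivative of D with respect to y. The Hamiltonian part of y' is J
  -- g, and it drops out of D' because g (J g) = 0.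
  set D : ℝ → ℝ := fun Z => V (x Z) - V (a Z) - G (a Z) (y Z) + 1 / 2 * Z⁻¹ * S (y Z) (y Z)
    with hD
  set D' : ℝ → ℝ := fun Z => ℓ * Z⁻¹ * g Z (y Z) - g Z (ρ Z)
    + (G (x Z) - G (a Z) - fderiv ℝ G (a Z) (y Z)) (a' Z) - 1 / 2 * Z⁻¹ ^ 2 * S (y Z) (y Z)
    with hD'
  have hxV := hx₀.eventually hV
  have haV := ha₀.eventually hV
  have haG := ha₀.eventually hGd
  have haS := ha₀.eventually hsymm
  have hDd : ∀ᶠ Z in atTop, HasDerivAt D (D' Z) Z := by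
    filter_upwards [hx, ha, hyd, hxV, haV, haG, haS, eventually_gt_atTop 0]
      with Z h1 h2 h3 h4 h5 h6 h7 hZ
    have e1 := h4.comp_hasDerivAt Z h1
    have e2 := h5.comp_hasDerivAt Z h2
    have e3 := (h6.comp_hasDerivAt Z h2).clm_apply h3
    have e4 : HasDerivAt (fun Z => S (y Z)) (S (y' Z)) Z :=
      S.hasFDerivAt.comp_hasDerivAt Z h3
    have e5 := ((hasDerivAt_inv hZ.ne').const_mul (1 / 2 : ℝ)).mul (e4.clm_apply h3)
    refine (((e1.sub e2).sub e3).add e5).congr_deriv ?_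
    have e6 : J (G (x Z) + Z⁻¹ • S (x Z)) + (ℓ * Z⁻¹) • x Z = a' Z + y' Z := by
      simp only [hy', hg, hρdef, hy, map_add, map_sub, map_smul, smul_sub]
      abel
    have e7 : g Z (y' Z) = ℓ * Z⁻¹ * g Z (y Z) - g Z (ρ Z) := by
      simp only [hy', map_add, map_sub, map_smul, hJ, smul_eq_mul, zero_add]
    rw [e6, hD']
    simp only
    rw [← e7]
    simp only [hg, map_add, add_apply, sub_apply,
      smul_apply, smul_eq_mul, Function.comp_apply]
    -- Symmetry of the second derivative groups the terms containing a' into the Taylor remainder of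
    -- G at a, which is quadratic in y.
    rw [h7 (a' Z) (y Z), hS (y' Z) (y Z)]
    field_simp
    ring
  have hinv : Tendsto (fun Z : ℝ => Z⁻¹) atTop (𝓝 0) := tendsto_inv_atTop_zero
  have hy0 : Tendsto y atTop (𝓝 0) := by
    simpa using hx₀.sub ha₀
  have hDlim : Tendsto D atTop (𝓝 0) := by
    have hVc := hV.self_of_nhds.continuousAt
    have e1 := (hVc.tendsto.comp hx₀).sub (hVc.tendsto.comp ha₀)
    have e0 : Tendsto (fun Z => G (a Z)) atTop (𝓝 (G x₀)) := hG.continuousAt.tendsto.comp ha₀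
    have e2 : Tendsto (fun Z => G (a Z) (y Z)) atTop (𝓝 (G x₀ 0)) :=
      (isBoundedBilinearMap_apply.continuous.tendsto (G x₀, (0 : E))).comp (e0.prodMk_nhds hy0)
    have e4 : Tendsto (fun Z => S (y Z)) atTop (𝓝 (S 0)) := (S.continuous.tendsto 0).comp hy0
    have e5 : Tendsto (fun Z => S (y Z) (y Z)) atTop (𝓝 (S 0 0)) :=
      (isBoundedBilinearMap_apply.continuous.tendsto (S 0, (0 : E))).comp (e4.prodMk_nhds hy0)
    have e3 := (hinv.const_mul (1 / 2 : ℝ)).mul e5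
    simpa [hD] using (e1.sub e2).add e3
  have hDlow : ∀ᶠ Z in atTop, c / 8 * ‖y Z‖ ^ 2 ≤ D Z := by
    have e : ∀ᶠ Z : ℝ in atTop, ‖S‖ * Z⁻¹ < c / 4 := by
      have := hinv.const_mul ‖S‖
      rw [mul_zero] at this
      exact this.eventually (gt_mem_nhds (by positivity))
    filter_upwards [hpair.eventually hbreg, e, eventually_gt_atTop 0] with Z h1 h2 hZ
    have h3 : |S (y Z) (y Z)| ≤ ‖S‖ * ‖y Z‖ * ‖y Z‖ := S.le_opNorm₂ (y Z) (y Z)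
    have h4 : -(‖S‖ * Z⁻¹ * ‖y Z‖ ^ 2) ≤ Z⁻¹ * S (y Z) (y Z) := by
      have := mul_le_mul_of_nonneg_left (neg_le_of_abs_le h3) (inv_pos.2 hZ).le
      linarith
    have h5 := mul_le_mul_of_nonneg_right h2.le (sq_nonneg ‖y Z‖)
    simp only [hD]
    linarith
  set M : ℝ := ‖A‖ + c / 4 + ‖S‖ with hM
  have hM0 : 0 < M := by positivity
  set α : ℝ := ℓ * c / 4 with hα
  have hα0 : 0 < α := by positivity
  set β : ℝ := M * Cρ with hβ
  have hDlo : ∀ᶠ Z in atTop, α * Z⁻¹ * ‖y Z‖ ^ 2 - β * ‖y Z‖ * Z⁻¹ ^ (m + 2) ≤ D' Z := by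
    have e : ∀ᶠ Z : ℝ in atTop, ‖S‖ * Z⁻¹ < c / 4 := by
      have := hinv.const_mul ‖S‖
      rw [mul_zero] at this
      exact this.eventually (gt_mem_nhds (by positivity))
    have e' : ∀ᶠ Z : ℝ in atTop, (C * Ca + ‖S‖) * Z⁻¹ < ℓ * c / 4 := by
      have := hinv.const_mul (C * Ca + ‖S‖)
      rw [mul_zero] at this
      exact this.eventually (gt_mem_nhds (by positivity))
    filter_upwards [hpair.eventually hlin, hpair.eventually hrem, hCa.bound, hCρ.bound, e, e',
      eventually_ge_atTop 1] with Z h1 h2 h3 h4 h5 h6 hZ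
    have hZ0 : 0 < Z := by linarith
    set τ := Z⁻¹ with hτ
    have hτ0 : 0 < τ := inv_pos.2 hZ0
    have hτ1 : τ ≤ 1 := inv_le_one_of_one_le₀ hZ
    set w := ‖y Z‖ with hw
    have hw0 : 0 ≤ w := norm_nonneg _
    rw [Real.norm_of_nonneg (by positivity)] at h3 h4
    change ‖G (x Z) - G (a Z) - A (y Z)‖ ≤ c / 4 * w at h1
    change ‖G (x Z) - G (a Z) - fderiv ℝ G (a Z) (y Z)‖ ≤ C * w ^ 2 at h2
    have hSy : ‖S (y Z)‖ ≤ ‖S‖ * w := S.le_opNorm _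
    have hSyy : |S (y Z) (y Z)| ≤ ‖S‖ * w * w := S.le_opNorm₂ (y Z) (y Z)
    have hge : g Z = (G (x Z) - G (a Z) - A (y Z)) + A (y Z) + τ • S (y Z) := by
      simp only [hg]; abel
    have hgn : ‖g Z‖ ≤ M * w := by
      rw [hge]
      refine (norm_add₃_le).trans ?_
      rw [norm_smul, Real.norm_of_nonneg hτ0.le]
      have : τ * ‖S (y Z)‖ ≤ 1 * (‖S‖ * w) := mul_le_mul hτ1 hSy (norm_nonneg _) zero_le_one
      have := A.le_opNorm (y Z)
      rw [hM]
      linarith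
    have hgy : c / 2 * w ^ 2 ≤ g Z (y Z) := by
      have e1 : |(G (x Z) - G (a Z) - A (y Z)) (y Z)| ≤ c / 4 * w * w :=
        ((G (x Z) - G (a Z) - A (y Z)).le_opNorm (y Z)).trans (by gcongr)
      have e2 := hpos (y Z)
      have e3 := mul_le_mul_of_nonneg_left (neg_le_of_abs_le hSyy) hτ0.le
      have e4 := neg_le_of_abs_le e1
      have e5 := mul_le_mul_of_nonneg_right h5.le (sq_nonneg w)
      rw [hge]
      simp only [add_apply, smul_apply, smul_eq_mul]
      linarith
    have hgρ : g Z (ρ Z) ≤ β * w * τ ^ (m + 2) := by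
      refine (le_abs_self _).trans (((g Z).le_opNorm (ρ Z)).trans ?_)
      calc ‖g Z‖ * ‖ρ Z‖ ≤ (M * w) * (Cρ * τ ^ (m + 2)) := by gcongr
        _ = _ := by rw [hβ]; ring
    have hr : -(C * w ^ 2 * (Ca * τ ^ 2))
        ≤ (G (x Z) - G (a Z) - fderiv ℝ G (a Z) (y Z)) (a' Z) := by
      refine neg_le_of_abs_le
        (((G (x Z) - G (a Z) - fderiv ℝ G (a Z) (y Z)).le_opNorm (a' Z)).trans ?_)
      gcongr
    have hSy2 : 1 / 2 * τ ^ 2 * S (y Z) (y Z) ≤ ‖S‖ * w ^ 2 * τ ^ 2 := by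
      have e1 := mul_le_mul_of_nonneg_left (le_of_abs_le hSyy) (sq_nonneg τ)
      have e2 : 0 ≤ τ ^ 2 * (‖S‖ * w * w) := by positivity
      linarith
    have h7 := mul_le_mul_of_nonneg_left hgy (show 0 ≤ ℓ * τ by positivity)
    have h8 := mul_le_mul_of_nonneg_right h6.le (show 0 ≤ τ * w ^ 2 by positivity)
    simp only [hD', hα]
    linarith
  -- This K completes the square in ατ|y|² - β|y|τ^(m+2) + Kτ^(2m+3).
  set K : ℝ := β ^ 2 / (4 * α) with hK
  have hΦ : ∀ᶠ Z in atTop, D Z - K * Z⁻¹ ^ (2 * m + 2) ≤ 0 := by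
    refine eventually_nonpos_of_deriv_nonneg
      (Φ' := fun Z => D' Z + K * (2 * m + 2) * Z⁻¹ ^ (2 * m + 3)) ?_ ?_ ?_
    · filter_upwards [hDd, eventually_gt_atTop 0] with Z h1 hZ
      refine (h1.sub (((hasDerivAt_inv hZ.ne').pow (2 * m + 2)).const_mul K)).congr_deriv ?_
      rw [show 2 * m + 2 - 1 = 2 * m + 1 by omega]
      push_cast
      rw [← inv_pow]
      ring
    · filter_upwards [hDlo, eventually_gt_atTop 0] with Z h1 hZ
      set τ := Z⁻¹ with hτ
      have hτ0 : 0 < τ := inv_pos.2 hZ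
      have e1 : α * τ * ‖y Z‖ ^ 2 - β * ‖y Z‖ * τ ^ (m + 2) + K * τ ^ (2 * m + 3)
          = α * τ * (‖y Z‖ - β / (2 * α) * τ ^ (m + 1)) ^ 2 := by
        rw [hK]
        field_simp
        ring
      have e2 : 0 ≤ α * τ * (‖y Z‖ - β / (2 * α) * τ ^ (m + 1)) ^ 2 := by positivity
      have e3 : 0 ≤ K * (2 * m + 1) * τ ^ (2 * m + 3) := by positivity
      linarith
    · simpa using hDlim.sub ((hinv.pow (2 * m + 2)).const_mul K)
  refine IsBigO.of_bound (Real.sqrt (8 * K / c)) ?_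
  filter_upwards [hΦ, hDlow, eventually_gt_atTop 0] with Z h1 h2 hZ
  have hτ0 : 0 < Z⁻¹ := inv_pos.2 hZ
  rw [Real.norm_of_nonneg (by positivity)]
  refine abs_le_of_sq_le_sq' ?_ (by positivity) |>.2
  rw [mul_pow, Real.sq_sqrt (by positivity)]
  have h3 : c / 8 * ‖y Z‖ ^ 2 ≤ K * (Z⁻¹ ^ (m + 1)) ^ 2 := by
    rw [← pow_mul, show (m + 1) * 2 = 2 * m + 2 by ring]
    linarith
  change ‖y Z‖ ^ 2 ≤ _
  rw [div_mul_eq_mul_div, le_div_iff₀ hc]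
  linarith

end Energy

end Capillary

namespace Capillary

/-! ### Every global solution tends to (1, 0); throughout, n = j + 2. -/

section Convergence

/-- The first integral of the autonomous system `R' = -tan θ`,
`θ' = (j + 1) (1 / cos θ - 1 / R)`. -/
def energy (j : ℕ) (r t : ℝ) : ℝ :=
  r ^ (j + 1) * Real.cos t - (j + 1) / (j + 2) * r ^ (j + 2)

theorem energy_eq (j : ℕ) (r t : ℝ) :
    energy j r t = r ^ (j + 1) * (Real.cos t - (j + 1) / (j + 2) * r) := by
  unfold energy
  ring

/-- Passing from j to j + 1 adds exactly (j + 2) r^(j+1) (1 - r)² ≥ 0. -/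
theorem sq_le_energyGap (j : ℕ) {r : ℝ} (hr : 0 ≤ r) :
    (1 - r) ^ 2 ≤ 1 - (j + 2) * r ^ (j + 1) + (j + 1) * r ^ (j + 2) := by
  induction j with
  | zero => simp; nlinarith
  | succ j ih =>
    have e : 0 ≤ (j + 2) * r ^ (j + 1) * (1 - r) ^ 2 := by positivity
    push_cast
    calc _ ≤ _ := ih
      _ ≤ 1 - (j + 2) * r ^ (j + 1) + (j + 1) * r ^ (j + 2)
          + (j + 2) * r ^ (j + 1) * (1 - r) ^ 2 := by linarith
      _ = _ := by ring

theorem exists_energyGap_le (j : ℕ) : ∃ C, 0 < C ∧ ∀ r : ℝ, 0 ≤ r → r ≤ 2 →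
    1 - (j + 2) * r ^ (j + 1) + (j + 1) * r ^ (j + 2) ≤ C * (1 - r) ^ 2 := by
  induction j with
  | zero => exact ⟨1, one_pos, fun r _ _ => by simp; nlinarith⟩
  | succ j ih =>
    obtain ⟨C, hC, ih⟩ := ih
    refine ⟨C + (j + 2) * 2 ^ (j + 1), by positivity, fun r hr hr2 => ?_⟩
    have e : (j + 2) * r ^ (j + 1) * (1 - r) ^ 2 ≤ (j + 2) * 2 ^ (j + 1) * (1 - r) ^ 2 := by
      gcongr
    push_cast
    calc _ = 1 - (j + 2) * r ^ (j + 1) + (j + 1) * r ^ (j + 2)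
          + (j + 2) * r ^ (j + 1) * (1 - r) ^ 2 := by ring
      _ ≤ C * (1 - r) ^ 2 + (j + 2) * 2 ^ (j + 1) * (1 - r) ^ 2 := add_le_add (ih r hr hr2) e
      _ = _ := by ring

theorem gap_eq (j : ℕ) (r t : ℝ) : (j + 2) * (1 / (j + 2) - energy j r t) =
    (1 - (j + 2) * r ^ (j + 1) + (j + 1) * r ^ (j + 2))
      + (j + 2) * (r ^ (j + 1) * (1 - Real.cos t)) := by
  unfold energy
  field_simp
  ring

theorem sq_le_gap (j : ℕ) {r : ℝ} (hr : 0 ≤ r) (t : ℝ) :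
    (1 - r) ^ 2 ≤ (j + 2) * (1 / (j + 2) - energy j r t) := by
  rw [gap_eq]
  have h1 := sq_le_energyGap j hr
  have h2 : 0 ≤ (j + 2) * (r ^ (j + 1) * (1 - Real.cos t)) :=
    mul_nonneg (by positivity) (mul_nonneg (by positivity) (sub_nonneg.2 (Real.cos_le_one t)))
  linarith

theorem energy_le (j : ℕ) {r : ℝ} (hr : 0 ≤ r) (t : ℝ) : energy j r t ≤ 1 / (j + 2) := by
  have h := (sq_nonneg _).trans (sq_le_gap j hr t)
  have := nonneg_of_mul_nonneg_right h (by positivity)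
  linarith

/-- The dissipation density r^(j+1) sin²θ/cos θ vanishes on θ = 0, so it does not by itself prevent
an orbit from lingering there. The left side is the autonomous part of the derivative of R(1 - R)
sin θ, which is strictly negative there away from the equilibrium. -/
theorem exists_dissipation_bound (j : ℕ) {η : ℝ} (hη : 0 < η) : ∃ c C, 0 < c ∧ 0 < C ∧
    ∀ r t : ℝ, 0 < r → r ≤ 2 → 0 < Real.cos t → energy j r t ≤ 1 / (j + 2) - η →
      (j + 1) * ((1 - r) * (r - Real.cos t)) - (1 - 2 * r) * (Real.sin t ^ 2 / Real.cos t)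
        ≤ -c + C * (r ^ (j + 1) * (Real.sin t ^ 2 / Real.cos t)) := by
  obtain ⟨CA, hCA, hA⟩ := exists_energyGap_le j
  set B : ℝ := CA + (j + 2) * 2 ^ (j + 1) with hB
  have hB0 : 0 < B := by positivity
  set e : ℝ := (j + 2) * η / B with he
  have he0 : 0 < e := by positivity
  set δ : ℝ := 1 / (4 * (j + 1)) with hδ
  have hδ0 : 0 < δ := by positivity
  have hδ4 : δ ≤ 1 / 4 := by
    rw [hδ]
    gcongr
    have : (0 : ℝ) ≤ j := by positivity
    linarith
  refine ⟨min (1 / 4) e, (j + 5) / δ ^ (j + 1), by positivity, by positivity, ?_⟩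
  intro r t hr hr2 hu hE
  set u := Real.cos t with hu'
  have hu1 : u ≤ 1 := Real.cos_le_one t
  have hs : Real.sin t ^ 2 = 1 - u ^ 2 := by
    have := Real.sin_sq_add_cos_sq t
    linarith
  set w : ℝ := Real.sin t ^ 2 / u with hw
  have hw0 : 0 ≤ w := by positivity
  have hws : u * w = Real.sin t ^ 2 := by rw [hw]; field_simp
  have hsw : Real.sin t ^ 2 ≤ w := by nlinarith
  have hj : (0 : ℝ) ≤ j := by positivity
  -- For small r the weight r^(j+1) is useless, but u + w = 1/u ≥ 1 already yields the bound -1/4.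
  -- For r > δ the weight is at least δ^(j+1) and absorbs (j + 5) w.
  rcases le_or_gt r δ with hrδ | hrδ
  · have h1 : (j + 1) * r ≤ 1 / 4 := by
      calc (j + 1) * r ≤ (j + 1) * δ := by gcongr
        _ = 1 / 4 := by rw [hδ]; field_simp
    have h2 : 1 ≤ u + w := by
      have : u * (u + w) = 1 := by rw [mul_add, hws, hs]; ring
      nlinarith
    have h3 : (j + 1) * ((1 - r) * (r - u)) ≤ 1 / 4 - u / 2 := by
      have e1 : (j + 1) * ((1 - r) * r) ≤ (j + 1) * r := by
        have : (1 - r) * r ≤ r := by nlinarith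
        gcongr
      have e2 : u / 2 ≤ (j + 1) * ((1 - r) * u) := by
        have : u / 2 ≤ (1 - r) * u := by nlinarith
        nlinarith
      nlinarith
    have h4 : w / 2 ≤ (1 - 2 * r) * w := by nlinarith
    have h5 : 0 ≤ (j + 5) / δ ^ (j + 1) * (r ^ (j + 1) * w) := by positivity
    have h6 := min_le_left (1 / 4) e
    linarith
  · have h1 : (1 - u) ≤ w := by nlinarith
    have h2 : e ≤ (1 - r) ^ 2 + Real.sin t ^ 2 := by
      rw [he, div_le_iff₀ hB0]
      have e1 := gap_eq j r t
      rw [← hu'] at e1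
      have e2 := hA r hr.le hr2
      have e3 : r ^ (j + 1) * (1 - u) ≤ 2 ^ (j + 1) * Real.sin t ^ 2 := by
        have : 1 - u ≤ Real.sin t ^ 2 := by rw [hs]; nlinarith
        have : 0 ≤ 1 - u := by linarith
        gcongr
      have e4 : (j + 2) * η ≤ (j + 2) * (1 / (j + 2) - energy j r t) := by
        gcongr; linarith
      have e5 : (j + 2) * (r ^ (j + 1) * (1 - u)) ≤ (j + 2) * (2 ^ (j + 1) * Real.sin t ^ 2) := by
        gcongr
      have e6 : 0 ≤ CA * Real.sin t ^ 2 := by positivity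
      have e7 : 0 ≤ (j + 2) * 2 ^ (j + 1) * (1 - r) ^ 2 := by positivity
      rw [hB]
      linarith
    have h3 : (j + 1) * ((1 - r) * (r - u)) ≤ -(1 - r) ^ 2 + (j + 1) * w := by
      have e1 : (1 - r) * (1 - u) ≤ w := by nlinarith
      have e2 : (j + 1) * ((1 - r) * (r - u))
          = -(1 - r) ^ 2 - j * (1 - r) ^ 2 + (j + 1) * ((1 - r) * (1 - u)) := by ring
      have e3 : 0 ≤ j * (1 - r) ^ 2 := by positivity
      have e4 : (j + 1) * ((1 - r) * (1 - u)) ≤ (j + 1) * w := by gcongr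
      linarith
    have h4 : -((1 - 2 * r) * w) ≤ 3 * w := by nlinarith
    have h5 : (j + 5) * w ≤ (j + 5) / δ ^ (j + 1) * (r ^ (j + 1) * w) := by
      calc (j + 5) * w = (j + 5) / δ ^ (j + 1) * (δ ^ (j + 1) * w) := by field_simp
        _ ≤ _ := by gcongr
    have h6 := min_le_right (1 / 4) e
    linarith

variable {j : ℕ} {R θ : ℝ → ℝ}

namespace IsSolution

theorem cos_pos {n : ℕ} (h : IsSolution n R θ) {Z : ℝ} (hZ : 0 < Z) : 0 < Real.cos (θ Z) :=
  Real.cos_pos_of_mem_Ioo (h.θ_mem Z hZ)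

theorem hasDerivAt_energy (h : IsSolution (j + 2) R θ) {Z : ℝ} (hZ : 0 < Z) :
    HasDerivAt (fun Z => energy j (R Z) (θ Z))
      ((j + 1) / (2 * Z) * (R Z ^ (j + 1) * Real.cos (θ Z) - R Z ^ (j + 2))) Z := by
  have hR := h.R_pos Z hZ
  have hu := h.cos_pos hZ
  have d1 := h.deriv_R Z hZ
  have d2 := h.deriv_θ Z hZ
  refine (((d1.pow (j + 1)).mul d2.cos).sub
    ((d1.pow (j + 2)).const_mul ((j + 1 : ℝ) / (j + 2)))).congr_deriv ?_
  rw [Real.tan_eq_sin_div_cos, show j + 2 - 1 = j + 1 by omega, Nat.add_sub_cancel]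
  simp only [Pi.pow_apply]
  push_cast
  field_simp
  ring

/-- The autonomous derivative of R^(j+2) sin θ contains (j + 1)(R^(j+2) - R^(j+1) cos θ), which
cancels the sign-indefinite derivative of the energy and leaves a dissipative term and an O(Z⁻²)
error. -/
theorem hasDerivAt_flux (h : IsSolution (j + 2) R θ) {Z : ℝ} (hZ : 0 < Z) :
    HasDerivAt (fun Z => energy j (R Z) (θ Z) + R Z ^ (j + 2) * Real.sin (θ Z) / (2 * Z))
      (-((j + 2) / (2 * Z)) * (R Z ^ (j + 1) * (Real.sin (θ Z) ^ 2 / Real.cos (θ Z)))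
        + j * (R Z ^ (j + 2) * Real.sin (θ Z)) / (4 * Z ^ 2)) Z := by
  have hR := h.R_pos Z hZ
  have hu := h.cos_pos hZ
  have d1 := h.deriv_R Z hZ
  have d2 := h.deriv_θ Z hZ
  refine ((h.hasDerivAt_energy hZ).add (((d1.pow (j + 2)).mul d2.sin).div
    ((hasDerivAt_id Z).const_mul 2) (by simpa using hZ.ne'))).congr_deriv ?_
  rw [Real.tan_eq_sin_div_cos, show j + 2 - 1 = j + 1 by omega]
  simp only [id, Pi.mul_apply, Pi.pow_apply]
  push_cast
  field_simp
  ring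

theorem hasDerivAt_test (h : IsSolution (j + 2) R θ) {Z : ℝ} (hZ : 0 < Z) :
    HasDerivAt (fun Z => R Z * (1 - R Z) * Real.sin (θ Z))
      ((j + 1) * ((1 - R Z) * (R Z - Real.cos (θ Z)))
        - (1 - 2 * R Z) * (Real.sin (θ Z) ^ 2 / Real.cos (θ Z))
        + Real.sin (θ Z) * (1 - 2 * R Z) * R Z / (2 * Z)) Z := by
  have hR := h.R_pos Z hZ
  have hu := h.cos_pos hZ
  have d1 := h.deriv_R Z hZ
  have d2 := h.deriv_θ Z hZ
  refine ((d1.mul (d1.const_sub 1)).mul d2.sin).congr_deriv ?_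
  rw [Real.tan_eq_sin_div_cos]
  simp only [Pi.mul_apply]
  push_cast
  field_simp
  ring

theorem antitoneOn_of_hasDerivAt_nonpos {f f' : ℝ → ℝ} {a : ℝ} (ha : 0 < a)
    (h : ∀ Z, 0 < Z → HasDerivAt f (f' Z) Z) (h' : ∀ Z, a < Z → f' Z ≤ 0) :
    AntitoneOn f (Set.Ici a) := by
  refine antitoneOn_of_deriv_nonpos (convex_Ici a)
    (fun Z hZ => (h Z (ha.trans_le hZ)).continuousAt.continuousWithinAt) ?_ ?_
  · intro Z hZ
    rw [interior_Ici] at hZ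
    exact (h Z (ha.trans hZ)).differentiableAt.differentiableWithinAt
  · intro Z hZ
    rw [interior_Ici] at hZ
    rw [(h Z (ha.trans hZ)).deriv]
    exact h' Z hZ

/-- The energy satisfies E' = (j+1)/(2Z) · (E - R^(j+2)/(j+2)), so Z^(-(j+1)/2) E is nonincreasing.
-/
theorem energy_nonpos_of_le (h : IsSolution (j + 2) R θ) {a Z : ℝ} (ha : 0 < a) (haZ : a ≤ Z)
    (hE : energy j (R a) (θ a) ≤ 0) : energy j (R Z) (θ Z) ≤ 0 := by
  have key := antitoneOn_of_hasDerivAt_nonpos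
    (f := fun Z => energy j (R Z) (θ Z) * Real.exp (-((j + 1) / 2 * Real.log Z)))
    (f' := fun Z => -((j + 1) / (2 * Z) * (R Z ^ (j + 2) / (j + 2))
      * Real.exp (-((j + 1) / 2 * Real.log Z)))) ha ?_ ?_
  · have h1 := key Set.self_mem_Ici haZ haZ
    have h2 : energy j (R a) (θ a) * Real.exp (-((j + 1) / 2 * Real.log a)) ≤ 0 :=
      mul_nonpos_of_nonpos_of_nonneg hE (Real.exp_pos _).le
    exact nonpos_of_mul_nonpos_left (h1.trans h2) (Real.exp_pos _)
  · intro Z hZ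
    have d : HasDerivAt (fun Z => Real.exp (-((j + 1) / 2 * Real.log Z)))
        (Real.exp (-((j + 1) / 2 * Real.log Z)) * -((j + 1) / 2 * Z⁻¹)) Z :=
      ((Real.hasDerivAt_log hZ.ne').const_mul ((j + 1 : ℝ) / 2)).neg.exp
    refine ((h.hasDerivAt_energy hZ).mul d).congr_deriv ?_
    unfold energy
    field_simp
    ring
  · intro Z hZ
    have hZ0 := ha.trans hZ
    have hR := h.R_pos Z hZ0
    have : 0 ≤ (j + 1) / (2 * Z) * (R Z ^ (j + 2) / (j + 2))
      * Real.exp (-((j + 1) / 2 * Real.log Z)) := by positivity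
    linarith

/-- Once E ≤ 0, cos θ ≤ (j+1)/(j+2) R forever, whence θ' ≥ 1/2. Over a length 2π the angle gains at
least π, the full width of its open interval. -/
theorem energy_pos (h : IsSolution (j + 2) R θ) {a : ℝ} (ha : 0 < a) :
    0 < energy j (R a) (θ a) := by
  by_contra hE
  have hE' := fun Z (haZ : a ≤ Z) => h.energy_nonpos_of_le ha haZ (not_lt.1 hE)
  have key := antitoneOn_of_hasDerivAt_nonpos (f := fun Z => 1 / 2 * Z - θ Z) ha
    (fun Z hZ => ((hasDerivAt_id Z).const_mul (1 / 2 : ℝ)).sub (h.deriv_θ Z hZ)) ?_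
  · have h1 := key Set.self_mem_Ici (show a + 2 * Real.pi ∈ Set.Ici a by
      simp [Real.pi_pos.le]) (by linarith [Real.pi_pos])
    have h2 := (h.θ_mem a ha).1
    have h3 := (h.θ_mem (a + 2 * Real.pi) (by linarith [Real.pi_pos])).2
    simp only at h1
    linarith
  · intro Z hZ
    have hZ0 := ha.trans hZ
    have hR := h.R_pos Z hZ0
    have hu := h.cos_pos hZ0
    have hu1 := Real.cos_le_one (θ Z)
    have h1 : R Z ^ (j + 1) * (Real.cos (θ Z) - (j + 1) / (j + 2) * R Z) ≤ 0 := by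
      rw [← energy_eq]
      exact hE' Z hZ.le
    have h2 : Real.cos (θ Z) ≤ (j + 1) / (j + 2) * R Z := by
      have := nonpos_of_mul_nonpos_right h1 (by positivity)
      linarith
    have h3 : 1 / R Z ≤ (j + 1) / (j + 2) * (1 / Real.cos (θ Z)) := by
      rw [mul_one_div, div_le_div_iff₀ hR hu]
      linarith
    have h4 : 1 ≤ 1 / Real.cos (θ Z) := by rw [le_div_iff₀ hu]; linarith
    have h5 : 1 / (j + 2) ≤ 1 / Real.cos (θ Z) - 1 / R Z := by
      have e : (1 : ℝ) / (j + 2) = 1 - (j + 1) / (j + 2) := by field_simp; ring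
      have e' : (0 : ℝ) ≤ 1 / (j + 2) := by positivity
      rw [e] at e' ⊢
      nlinarith
    have h6 : (1 : ℝ) / 2 ≤ (j + 1) * (1 / (j + 2)) := by
      have : (0 : ℝ) ≤ j := by positivity
      rw [mul_one_div, div_le_div_iff₀ (by norm_num) (by positivity)]
      linarith
    have h7 : (j + 1) * (1 / (j + 2)) ≤ (j + 1) * (1 / Real.cos (θ Z) - 1 / R Z) := by gcongr
    push_cast
    linarith

theorem R_le_two (h : IsSolution (j + 2) R θ) {Z : ℝ} (hZ : 0 < Z) : R Z ≤ 2 := by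
  have hR := h.R_pos Z hZ
  have hE := h.energy_pos hZ
  have h1 : 0 < R Z ^ (j + 1) * (Real.cos (θ Z) - (j + 1) / (j + 2) * R Z) := by
    rwa [← energy_eq]
  have h2 := pos_of_mul_pos_right h1 (by positivity)
  have h3 : (1 : ℝ) / 2 ≤ (j + 1) / (j + 2) := by
    have : (0 : ℝ) ≤ j := by positivity
    rw [div_le_div_iff₀ (by norm_num) (by positivity)]
    linarith
  have h4 := Real.cos_le_one (θ Z)
  nlinarith

theorem abs_pow_mul_sin_le (h : IsSolution (j + 2) R θ) {Z : ℝ} (hZ : 0 < Z) :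
    |R Z ^ (j + 2) * Real.sin (θ Z)| ≤ 2 ^ (j + 2) := by
  have hR := h.R_pos Z hZ
  have h2 := h.R_le_two hZ
  rw [abs_mul, abs_of_nonneg (by positivity)]
  calc R Z ^ (j + 2) * |Real.sin (θ Z)| ≤ 2 ^ (j + 2) * 1 := by
        gcongr; exact Real.abs_sin_le_one _
    _ = _ := mul_one _

theorem flux_deriv_le (h : IsSolution (j + 2) R θ) {Z : ℝ} (hZ : 0 < Z) :
    j * (R Z ^ (j + 2) * Real.sin (θ Z)) / (4 * Z ^ 2) ≤ j * 2 ^ j / Z ^ 2 := by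
  rw [div_le_div_iff₀ (by positivity) (by positivity)]
  have h1 := (abs_le.1 (h.abs_pow_mul_sin_le hZ)).2
  have h2 : j * (R Z ^ (j + 2) * Real.sin (θ Z)) * Z ^ 2 ≤ j * 2 ^ (j + 2) * Z ^ 2 := by
    gcongr
  refine h2.trans (le_of_eq ?_)
  ring

theorem antitoneOn_flux (h : IsSolution (j + 2) R θ) {a : ℝ} (ha : 0 < a) :
    AntitoneOn (fun Z => energy j (R Z) (θ Z) + R Z ^ (j + 2) * Real.sin (θ Z) / (2 * Z)
      + j * 2 ^ j * Z⁻¹) (Set.Ici a) := by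
  refine antitoneOn_of_hasDerivAt_nonpos ha (fun Z hZ => (h.hasDerivAt_flux hZ).add
    ((hasDerivAt_inv hZ.ne').const_mul (j * 2 ^ j : ℝ))) fun Z hZ => ?_
  have hZ0 := ha.trans hZ
  have hR := h.R_pos Z hZ0
  have hu := h.cos_pos hZ0
  have h1 := h.flux_deriv_le hZ0
  have h2 : 0 ≤ (j + 2) / (2 * Z) * (R Z ^ (j + 1) * (Real.sin (θ Z) ^ 2 / Real.cos (θ Z))) := by
    positivity
  rw [div_eq_mul_inv _ (Z ^ 2)] at h1
  linarith

/-- Otherwise the flux, corrected by a multiple of R(1 - R) sin θ/Z, would fall at least like -log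
Z, although the positive energy and R ≤ 2 bound it below. -/
theorem exists_energy_gt (h : IsSolution (j + 2) R θ) {η a : ℝ} (hη : 0 < η) (ha : 1 ≤ a) :
    ∃ Z, a ≤ Z ∧ 1 / (j + 2) - η < energy j (R Z) (θ Z) := by
  by_contra! hE
  have ha0 : 0 < a := by linarith
  obtain ⟨c, C, hc, hC, hcC⟩ := exists_dissipation_bound j hη
  -- With this κ the flux dissipation exactly pays for the term C·f of `exists_dissipation_bound`,
  -- leaving -κc/Z.
  set κ : ℝ := (j + 2) / (2 * C) with hκ
  have hκ0 : 0 < κ := by positivity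
  -- Collects the O(Z⁻²) errors: j·2^j from the flux, 3κ from the 1/Z part of the test function's
  -- derivative, 2κ from differentiating Z⁻¹.
  set C₁ : ℝ := j * 2 ^ j + 5 * κ with hC₁
  have key := antitoneOn_of_hasDerivAt_nonpos ha0
    (f := fun Z => energy j (R Z) (θ Z) + R Z ^ (j + 2) * Real.sin (θ Z) / (2 * Z)
      + κ * (R Z * (1 - R Z) * Real.sin (θ Z) * Z⁻¹) + κ * c * Real.log Z + C₁ * Z⁻¹)
    (fun Z hZ => ((((h.hasDerivAt_flux hZ).add (((h.hasDerivAt_test hZ).mul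
      (hasDerivAt_inv hZ.ne')).const_mul κ)).add
        ((Real.hasDerivAt_log hZ.ne').const_mul (κ * c))).add
          ((hasDerivAt_inv hZ.ne').const_mul C₁))) ?_
  · have hlow : ∀ Z, a ≤ Z → κ * c * Real.log Z ≤
        (energy j (R a) (θ a) + R a ^ (j + 2) * Real.sin (θ a) / (2 * a)
          + κ * (R a * (1 - R a) * Real.sin (θ a) * a⁻¹) + κ * c * Real.log a + C₁ * a⁻¹)
          + 2 ^ (j + 2) + 2 * κ := by
      intro Z hZ
      have hZ1 : 1 ≤ Z := ha.trans hZ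
      have hZ0 : 0 < Z := by linarith
      have h1 := key Set.self_mem_Ici hZ hZ
      simp only at h1
      have h2 := h.energy_pos hZ0
      have h3 : -(2 ^ (j + 2)) ≤ R Z ^ (j + 2) * Real.sin (θ Z) / (2 * Z) := by
        have e := (abs_le.1 (h.abs_pow_mul_sin_le hZ0)).1
        rw [le_div_iff₀ (by positivity)]
        have : (0 : ℝ) < 2 ^ (j + 2) := by positivity
        nlinarith
      have h4 : -(2 * κ) ≤ κ * (R Z * (1 - R Z) * Real.sin (θ Z) * Z⁻¹) := by
        have hR := h.R_pos Z hZ0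
        have hR2 := h.R_le_two hZ0
        have e1 : |R Z * (1 - R Z) * Real.sin (θ Z) * Z⁻¹| ≤ 2 * 1 * 1 * 1 := by
          rw [abs_mul, abs_mul, abs_mul]
          have a1 : |R Z| ≤ 2 := abs_le.2 ⟨by linarith, hR2⟩
          have a2 : |1 - R Z| ≤ 1 := abs_le.2 ⟨by linarith, by linarith⟩
          have a3 := Real.abs_sin_le_one (θ Z)
          have a4 : |Z⁻¹| ≤ 1 := by
            rw [abs_of_nonneg (inv_pos.2 hZ0).le]; exact inv_le_one_of_one_le₀ hZ1
          gcongr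
        have e2 := (abs_le.1 e1).1
        nlinarith
      have h5 : 0 ≤ C₁ * Z⁻¹ := by positivity
      linarith
    have hlim : Tendsto (fun Z => κ * c * Real.log Z) atTop atTop :=
      Real.tendsto_log_atTop.const_mul_atTop (by positivity)
    obtain ⟨Z, h1, h2⟩ := ((hlim.eventually_gt_atTop _).and (eventually_ge_atTop a)).exists
    exact absurd (hlow Z h2) (not_le.2 h1)
  · intro Z hZ
    have hZ0 := ha0.trans hZ
    have hR := h.R_pos Z hZ0
    have hR2 := h.R_le_two hZ0
    have hu := h.cos_pos hZ0
    have h1 := h.flux_deriv_le hZ0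
    have h2 := hcC (R Z) (θ Z) hR hR2 hu (hE Z hZ.le)
    set f := R Z ^ (j + 1) * (Real.sin (θ Z) ^ 2 / Real.cos (θ Z)) with hf
    set q := (j + 1) * ((1 - R Z) * (R Z - Real.cos (θ Z)))
      - (1 - 2 * R Z) * (Real.sin (θ Z) ^ 2 / Real.cos (θ Z)) with hq
    set τ := Z⁻¹ with hτ
    have hτ0 : 0 < τ := inv_pos.2 hZ0
    have hs := abs_le.1 (Real.abs_sin_le_one (θ Z))
    have h3 : Real.sin (θ Z) * (1 - 2 * R Z) * R Z / (2 * Z) ≤ 3 * τ := by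
      rw [hτ, ← div_eq_mul_inv, div_le_div_iff₀ (by positivity) hZ0]
      have : Real.sin (θ Z) * (1 - 2 * R Z) * R Z ≤ 6 := by
        refine (le_abs_self _).trans ?_
        rw [abs_mul, abs_mul]
        calc |Real.sin (θ Z)| * |1 - 2 * R Z| * |R Z| ≤ 1 * 3 * 2 := by
              have a1 : |R Z| ≤ 2 := abs_le.2 ⟨by linarith, hR2⟩
              have a2 : |1 - 2 * R Z| ≤ 3 := abs_le.2 ⟨by linarith, by linarith⟩
              have a3 := Real.abs_sin_le_one (θ Z)
              gcongr
          _ = 6 := by norm_num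
      nlinarith
    have h4 : -(R Z * (1 - R Z) * Real.sin (θ Z)) ≤ 2 := by
      refine (neg_le_abs _).trans ?_
      rw [abs_mul, abs_mul]
      calc |R Z| * |1 - R Z| * |Real.sin (θ Z)| ≤ 2 * 1 * 1 := by
            have a1 : |R Z| ≤ 2 := abs_le.2 ⟨by linarith, hR2⟩
            have a2 : |1 - R Z| ≤ 1 := abs_le.2 ⟨by linarith, by linarith⟩
            have a3 := Real.abs_sin_le_one (θ Z)
            gcongr
        _ = 2 := by norm_num
    have h5 : j * (R Z ^ (j + 2) * Real.sin (θ Z)) / (4 * Z ^ 2) ≤ j * 2 ^ j * τ ^ 2 := by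
      rw [hτ, inv_pow, ← div_eq_mul_inv]; exact h1
    have h6 : (j + 2) / (2 * Z) = κ * C * τ := by
      rw [hκ, hτ]; field_simp
    have h7 : -(Z ^ 2)⁻¹ = -τ ^ 2 := by rw [hτ, inv_pow]
    rw [h6, h7]
    have m1 := mul_le_mul_of_nonneg_left h2 (show 0 ≤ κ * τ by positivity)
    have m2 := mul_le_mul_of_nonneg_left h3 (show 0 ≤ κ * τ by positivity)
    have m3 := mul_le_mul_of_nonneg_left h4 (show 0 ≤ κ * τ ^ 2 by positivity)
    rw [hC₁]
    linarith

theorem tendsto_energy (h : IsSolution (j + 2) R θ) :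
    Tendsto (fun Z => energy j (R Z) (θ Z)) atTop (𝓝 (1 / (j + 2))) := by
  set B : ℝ := 2 ^ (j + 2) + j * 2 ^ j with hB
  have hlow : ∀ Z, 1 ≤ Z → 1 / (j + 2) - B * Z⁻¹ ≤ energy j (R Z) (θ Z) := by
    intro Z hZ
    -- The flux is nearly nonincreasing, so a later time W with energy above 1/(j+2) - η bounds the
    -- energy at Z from below; B does not depend on η.
    refine le_of_forall_pos_sub_le fun η hη => ?_
    obtain ⟨W, hW, hWE⟩ := h.exists_energy_gt hη hZ
    have hZ0 : 0 < Z := by linarith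
    have hW0 : 0 < W := by linarith
    have h1 := h.antitoneOn_flux hZ0 Set.self_mem_Ici hW hW
    simp only at h1
    have hb : ∀ X, 0 < X → |R X ^ (j + 2) * Real.sin (θ X) / (2 * X)| ≤ 2 ^ (j + 2) / 2 * X⁻¹ := by
      intro X hX
      rw [abs_div, abs_of_pos (show 0 < 2 * X by positivity), div_le_iff₀ (by positivity)]
      refine (h.abs_pow_mul_sin_le hX).trans (le_of_eq ?_)
      field_simp
    have h2 := (abs_le.1 (hb Z hZ0)).2
    have h3 := (abs_le.1 (hb W hW0)).1
    have h4 : W⁻¹ ≤ Z⁻¹ := inv_anti₀ hZ0 hW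
    have h5 : (2 : ℝ) ^ (j + 2) / 2 * W⁻¹ ≤ 2 ^ (j + 2) / 2 * Z⁻¹ := by gcongr
    have h6 : (0 : ℝ) ≤ j * 2 ^ j * W⁻¹ := by positivity
    rw [hB]
    linarith
  have hlim : Tendsto (fun Z : ℝ => 1 / (j + 2) - B * Z⁻¹) atTop (𝓝 (1 / (j + 2))) := by
    simpa using (tendsto_inv_atTop_zero.const_mul B).const_sub (1 / (j + 2 : ℝ))
  refine tendsto_of_tendsto_of_tendsto_of_le_of_le' hlim tendsto_const_nhds ?_ ?_
  · filter_upwards [eventually_ge_atTop 1] with Z hZ using hlow Z hZ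
  · filter_upwards [eventually_gt_atTop 0] with Z hZ using energy_le j (h.R_pos Z hZ).le _

theorem tendsto_R (h : IsSolution (j + 2) R θ) : Tendsto R atTop (𝓝 1) := by
  have h1 : Tendsto (fun Z => (j + 2) * (1 / (j + 2) - energy j (R Z) (θ Z))) atTop (𝓝 0) := by
    simpa using (h.tendsto_energy.const_sub (1 / (j + 2 : ℝ))).const_mul (j + 2 : ℝ)
  have h2 : Tendsto (fun Z => (1 - R Z) ^ 2) atTop (𝓝 0) := by
    refine squeeze_zero' (Eventually.of_forall fun Z => sq_nonneg _) ?_ h1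
    filter_upwards [eventually_gt_atTop 0] with Z hZ using sq_le_gap j (h.R_pos Z hZ).le _
  have h3 : Tendsto (fun Z => 1 - R Z) atTop (𝓝 0) := by
    have := h2.sqrt
    simp only [Real.sqrt_sq_eq_abs, Real.sqrt_zero] at this
    exact (tendsto_zero_iff_abs_tendsto_zero _).2 this
  simpa using h3.const_sub 1

theorem tendsto_θ (h : IsSolution (j + 2) R θ) : Tendsto θ atTop (𝓝 0) := by
  have h1 : Tendsto (fun Z => Real.cos (θ Z)) atTop (𝓝 1) := by
    have e := (h.tendsto_energy.add ((h.tendsto_R.pow (j + 2)).const_mul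
      ((j + 1 : ℝ) / (j + 2)))).div (h.tendsto_R.pow (j + 1)) (by simp)
    have e1 : (1 / (j + 2) + (j + 1) / (j + 2) * 1 ^ (j + 2)) / 1 ^ (j + 1) = (1 : ℝ) := by
      simp only [one_pow]
      field_simp
      ring
    rw [e1] at e
    refine e.congr' ?_
    filter_upwards [eventually_gt_atTop 0] with Z hZ
    have hR := h.R_pos Z hZ
    simp only [Pi.div_apply, energy]
    field_simp
    ring
  have h2 : Tendsto (fun Z => Real.arccos (Real.cos (θ Z))) atTop (𝓝 0) := by
    have := (Real.continuous_arccos.tendsto 1).comp h1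
    rwa [Real.arccos_one] at this
  refine (tendsto_zero_iff_abs_tendsto_zero _).2 (h2.congr' ?_)
  filter_upwards [eventually_gt_atTop 0] with Z hZ
  obtain ⟨h3, h4⟩ := h.θ_mem Z hZ
  rw [Function.comp_apply, ← Real.cos_abs, Real.arccos_cos (abs_nonneg _)]
  refine abs_le.2 ⟨by linarith [Real.pi_pos], by linarith [Real.pi_pos]⟩

end IsSolution

end Convergence

end Capillary

namespace Capillary

/-! ### Canonical coordinates and the asymptotic expansion. -/

section Asymptotics

/-- The negative of the first integral in the coordinates `(R ^ n / n, sin θ)`, `n = j + 2`. -/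
def potential (j : ℕ) (p : ℝ × ℝ) : ℝ :=
  (j + 1) * p.1 - ((j + 2) * p.1) ^ ((j + 1) / (j + 2) : ℝ) * √(1 - p.2 ^ 2)

/-- The differential of `potential`. -/
def dPotential (j : ℕ) (p : ℝ × ℝ) : ℝ × ℝ →L[ℝ] ℝ :=
  ((j + 1) * (1 - ((j + 2) * p.1) ^ (-(1 / (j + 2)) : ℝ) * √(1 - p.2 ^ 2))) •
      ContinuousLinearMap.fst ℝ ℝ ℝ +
    (((j + 2) * p.1) ^ ((j + 1) / (j + 2) : ℝ) * (√(1 - p.2 ^ 2))⁻¹ * p.2) •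
      ContinuousLinearMap.snd ℝ ℝ ℝ

/-- The standard symplectic rotation on covectors. -/
def symplecticJ : (ℝ × ℝ →L[ℝ] ℝ) →ₗ[ℝ] ℝ × ℝ where
  toFun f := (-f (0, 1), f (1, 0))
  map_add' f g := by simp [add_comm]
  map_smul' c f := by simp

theorem apply_symplecticJ (f : ℝ × ℝ →L[ℝ] ℝ) : f (symplecticJ f) = 0 := by
  have e : symplecticJ f = (-f (0, 1)) • ((1 : ℝ), (0 : ℝ)) + (f (1, 0)) • ((0 : ℝ), (1 : ℝ)) := by
    simp [symplecticJ]
  rw [e, map_add, map_smul, map_smul, smul_eq_mul, smul_eq_mul]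
  ring

/-- The symmetric bilinear form of the `1 / Z` correction to the potential. -/
def correctionForm (j : ℕ) : ℝ × ℝ →L[ℝ] ℝ × ℝ →L[ℝ] ℝ :=
  (-((j + 2) / 4 : ℝ)) •
    ((ContinuousLinearMap.snd ℝ ℝ ℝ).smulRight (ContinuousLinearMap.fst ℝ ℝ ℝ) +
      (ContinuousLinearMap.fst ℝ ℝ ℝ).smulRight (ContinuousLinearMap.snd ℝ ℝ ℝ))

theorem correctionForm_apply (j : ℕ) (v w : ℝ × ℝ) :
    correctionForm j v w = -((j + 2) / 4) * (v.2 * w.1 + v.1 * w.2) := by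
  simp [correctionForm]
  ring

theorem hasDerivAt_rpow_scaled (j : ℕ) (e : ℝ) {P : ℝ} (hP : 0 < P) :
    HasDerivAt (fun P : ℝ => ((j + 2) * P) ^ e) ((j + 2) * e * ((j + 2) * P) ^ (e - 1)) P := by
  have h := ((hasDerivAt_id P).const_mul ((j : ℝ) + 2)).rpow_const (p := e)
    (Or.inl (by simp only [id]; positivity))
  refine h.congr_deriv ?_
  simp only [id]
  ring

theorem hasDerivAt_sqrt_one_sub_sq {q : ℝ} (hq : q ^ 2 < 1) :
    HasDerivAt (fun q : ℝ => √(1 - q ^ 2)) (-(q * (√(1 - q ^ 2))⁻¹)) q := by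
  have hne : 1 - q ^ 2 ≠ 0 := by linarith
  refine (((hasDerivAt_pow 2 q).const_sub 1).sqrt hne).congr_deriv ?_
  have : √(1 - q ^ 2) ≠ 0 := Real.sqrt_ne_zero'.2 (by linarith)
  push_cast
  field_simp

theorem hasFDerivAt_potential (j : ℕ) {p : ℝ × ℝ} (h1 : 0 < p.1) (h2 : p.2 ^ 2 < 1) :
    HasFDerivAt (potential j) (dPotential j p) p := by
  have f1 : HasFDerivAt (fun p : ℝ × ℝ => p.1) (ContinuousLinearMap.fst ℝ ℝ ℝ) p := hasFDerivAt_fst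
  have f2 : HasFDerivAt (fun p : ℝ × ℝ => p.2) (ContinuousLinearMap.snd ℝ ℝ ℝ) p := hasFDerivAt_snd
  have d1 := HasDerivAt.comp_hasFDerivAt (f := fun p : ℝ × ℝ => p.1) p
    (hasDerivAt_rpow_scaled j ((j + 1) / (j + 2)) h1) f1
  have d2 := HasDerivAt.comp_hasFDerivAt (f := fun p : ℝ × ℝ => p.2) p
    (hasDerivAt_sqrt_one_sub_sq h2) f2
  have d3 := f1.const_mul ((j : ℝ) + 1)
  refine (d3.sub (d1.mul d2)).congr_fderiv ?_
  have e1 : ((j : ℝ) + 1) / (j + 2) - 1 = -(1 / (j + 2)) := by field_simp; ring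
  have e2 : ((j : ℝ) + 2) * ((j + 1) / (j + 2)) = j + 1 := by field_simp
  rw [e1, e2]
  ext <;> simp [dPotential] <;> ring

theorem contDiffAt_dPotential (j : ℕ) :
    ContDiffAt ℝ 2 (dPotential j) (1 / (j + 2), 0) := by
  have hne : ((j : ℝ) + 2) * (1 / (j + 2)) ≠ 0 := by
    have : (j : ℝ) + 2 ≠ 0 := by positivity
    field_simp
    norm_num
  have hs : ContDiffAt ℝ 2 (fun p : ℝ × ℝ => √(1 - p.2 ^ 2)) (1 / (j + 2), 0) :=
    ContDiffAt.sqrt (by fun_prop) (by norm_num)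
  have hr : ∀ e : ℝ, ContDiffAt ℝ 2 (fun p : ℝ × ℝ => ((j + 2) * p.1) ^ e) (1 / (j + 2), 0) :=
    fun e => ContDiffAt.rpow_const_of_ne (by fun_prop) hne
  refine ContDiffAt.add ?_ ?_
  · exact (contDiffAt_const.mul (contDiffAt_const.sub ((hr _).mul hs))).smul contDiffAt_const
  · exact (((hr _).mul (hs.inv (by norm_num))).mul contDiffAt_snd).smul contDiffAt_const

theorem fderiv_dPotential_apply (j : ℕ) (v : ℝ × ℝ) :
    fderiv ℝ (dPotential j) (1 / (j + 2), 0) v v = (j + 1) * v.1 ^ 2 + v.2 ^ 2 := by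
  set p : ℝ × ℝ := (1 / (j + 2), 0) with hp
  have h1 : 0 < p.1 := by rw [hp]; positivity
  have h2 : p.2 ^ 2 < 1 := by simp [hp]
  have hone : ((j : ℝ) + 2) * p.1 = 1 := by rw [hp]; field_simp
  have f1 : HasFDerivAt (fun p : ℝ × ℝ => p.1) (ContinuousLinearMap.fst ℝ ℝ ℝ) p := hasFDerivAt_fst
  have f2 : HasFDerivAt (fun p : ℝ × ℝ => p.2) (ContinuousLinearMap.snd ℝ ℝ ℝ) p := hasFDerivAt_snd
  have d1 := HasDerivAt.comp_hasFDerivAt (f := fun p : ℝ × ℝ => p.1) p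
    (hasDerivAt_rpow_scaled j ((j + 1) / (j + 2)) h1) f1
  have d1' := HasDerivAt.comp_hasFDerivAt (f := fun p : ℝ × ℝ => p.1) p
    (hasDerivAt_rpow_scaled j (-(1 / (j + 2))) h1) f1
  have d2 := HasDerivAt.comp_hasFDerivAt (f := fun p : ℝ × ℝ => p.2) p
    (hasDerivAt_sqrt_one_sub_sq h2) f2
  have d2' := HasDerivAt.comp_hasFDerivAt (f := fun p : ℝ × ℝ => p.2) p
    ((hasDerivAt_sqrt_one_sub_sq h2).inv (by simp [hp])) f2
  have dα := (((d1'.mul d2).const_sub 1).const_mul ((j : ℝ) + 1)).smul_const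
    (ContinuousLinearMap.fst ℝ ℝ ℝ)
  have dβ := ((d1.mul d2').mul f2).smul_const
    (ContinuousLinearMap.snd ℝ ℝ ℝ)
  have d := (dα.add dβ).fderiv
  have hd : fderiv ℝ (dPotential j) p = _ := d
  rw [hd]
  have hq : p.2 = 0 := rfl
  simp [hone, hq]
  field_simp

theorem norm_sq_le_fderiv_dPotential (j : ℕ) (v : ℝ × ℝ) :
    1 * ‖v‖ ^ 2 ≤ fderiv ℝ (dPotential j) (1 / (j + 2), 0) v v := by
  rw [fderiv_dPotential_apply, Prod.norm_def, one_mul]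
  have hj : 0 ≤ (j : ℝ) * v.1 ^ 2 := by positivity
  rcases max_cases ‖v.1‖ ‖v.2‖ with ⟨h, -⟩ | ⟨h, -⟩ <;> rw [h, Real.norm_eq_abs, sq_abs] <;>
    nlinarith [sq_nonneg v.1, sq_nonneg v.2]

/-- In these coordinates the term R/(2Z) acts as the matrix diag(n/2, 0)/Z. Its trace part is the
dilation n/(4Z), and the traceless rest diag(n/4, -n/4)/Z is the Hamiltonian field of
`correctionForm`. -/
theorem hamiltonian_field_eq (j : ℕ) {r t Z : ℝ} (hr : 0 < r) (hu : 0 < Real.cos t) (hZ : 0 < Z) :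
    symplecticJ (dPotential j (r ^ (j + 2) / (j + 2), Real.sin t)
        + Z⁻¹ • correctionForm j (r ^ (j + 2) / (j + 2), Real.sin t))
      + ((j + 2) / 4 * Z⁻¹) • ((r ^ (j + 2) / (j + 2), Real.sin t) : ℝ × ℝ) =
    (r ^ (j + 1) * (-Real.tan t + r / (2 * Z)),
      Real.cos t * ((j + 1) * (1 / Real.cos t - 1 / r))) := by
  have hs : √(1 - Real.sin t ^ 2) = Real.cos t := by
    rw [← Real.cos_sq', Real.sqrt_sq hu.le]
  have e0 : ((j : ℝ) + 2) * (r ^ (j + 2) / (j + 2)) = r ^ (((j : ℝ) + 2)) := by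
    rw [← Real.rpow_natCast]
    push_cast
    field_simp
  have e1 : (((j : ℝ) + 2) * (r ^ (j + 2) / (j + 2))) ^ ((j + 1) / (j + 2) : ℝ) = r ^ (j + 1) := by
    rw [e0, ← Real.rpow_mul hr.le, ← Real.rpow_natCast]
    congr 1
    push_cast
    field_simp
  have e2 : (((j : ℝ) + 2) * (r ^ (j + 2) / (j + 2))) ^ (-(1 / (j + 2)) : ℝ) = r⁻¹ := by
    rw [e0, ← Real.rpow_mul hr.le, ← Real.rpow_neg_one]
    congr 1
    field_simp
  ext
  · simp only [symplecticJ, dPotential, e1, e2, hs, correctionForm_apply, LinearMap.coe_mk,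
      AddHom.coe_mk, Real.tan_eq_sin_div_cos, add_apply, smul_apply, smul_eq_mul,
      ContinuousLinearMap.coe_fst', ContinuousLinearMap.coe_snd', Prod.fst_add, Prod.smul_fst]
    field_simp
    ring
  · simp only [symplecticJ, dPotential, e1, e2, hs, correctionForm_apply, LinearMap.coe_mk,
      AddHom.coe_mk, add_apply, smul_apply, smul_eq_mul,
      ContinuousLinearMap.coe_fst', ContinuousLinearMap.coe_snd', Prod.snd_add, Prod.smul_snd]
    field_simp
    ring

theorem hasDerivAt_canonical (j : ℕ) {r t : ℝ → ℝ} {r' t' Z : ℝ} (hr : HasDerivAt r r' Z)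
    (ht : HasDerivAt t t' Z) :
    HasDerivAt (fun Z => ((r Z ^ (j + 2) / (j + 2), Real.sin (t Z)) : ℝ × ℝ))
      (r Z ^ (j + 1) * r', Real.cos (t Z) * t') Z := by
  refine HasDerivAt.prodMk (((hr.pow (j + 2)).div_const ((j : ℝ) + 2)).congr_deriv ?_) ht.sin
  rw [show j + 2 - 1 = j + 1 by omega]
  push_cast
  field_simp

theorem tendsto_canonical (j : ℕ) {r t : ℝ → ℝ} (hr : Tendsto r atTop (𝓝 1))
    (ht : Tendsto t atTop (𝓝 0)) :
    Tendsto (fun Z => ((r Z ^ (j + 2) / (j + 2), Real.sin (t Z)) : ℝ × ℝ)) atTop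
      (𝓝 (1 / (j + 2), 0)) := by
  refine Tendsto.prodMk_nhds ?_ ?_
  · simpa using (hr.pow (j + 2)).div_const ((j : ℝ) + 2)
  · simpa [Function.comp_def] using (Real.continuous_sin.tendsto 0).comp ht

/-- Both r ↦ r^(j+2) at 1 and sin at 0 have nonzero strict derivative, so differences of values and
of arguments are comparable. -/
theorem sub_isBigO_of_canonical {j : ℕ} {r t r₁ t₁ : ℝ → ℝ} (hr : Tendsto r atTop (𝓝 1))
    (ht : Tendsto t atTop (𝓝 0)) (hr₁ : Tendsto r₁ atTop (𝓝 1)) (ht₁ : Tendsto t₁ atTop (𝓝 0))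
    {b : ℝ → ℝ} (h : (fun Z => ((r Z ^ (j + 2) / (j + 2), Real.sin (t Z)) : ℝ × ℝ)
      - (r₁ Z ^ (j + 2) / (j + 2), Real.sin (t₁ Z))) =O[atTop] b) :
    (fun Z => r Z - r₁ Z) =O[atTop] b ∧ (fun Z => t Z - t₁ Z) =O[atTop] b := by
  constructor
  · have h1 : (fun Z => r Z ^ (j + 2) / (j + 2) - r₁ Z ^ (j + 2) / (j + 2)) =O[atTop] b :=
      (isBigO_fst_prod' (f' := fun Z => ((r Z ^ (j + 2) / (j + 2), Real.sin (t Z)) : ℝ × ℝ)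
        - (r₁ Z ^ (j + 2) / (j + 2), Real.sin (t₁ Z)))).trans h
    have h2 : (fun Z => r Z ^ (j + 2) - r₁ Z ^ (j + 2)) =O[atTop] b := by
      refine (h1.const_mul_left ((j : ℝ) + 2)).congr_left fun Z => ?_
      field_simp
    have h3 := ((hasStrictDerivAt_pow (j + 2) (1 : ℝ)).isTheta_sub (by simp; positivity)).isBigO_symm
    exact (h3.comp_tendsto (hr.prodMk_nhds hr₁)).trans h2
  · have h1 : (fun Z => Real.sin (t Z) - Real.sin (t₁ Z)) =O[atTop] b :=
      (isBigO_snd_prod' (f' := fun Z => ((r Z ^ (j + 2) / (j + 2), Real.sin (t Z)) : ℝ × ℝ)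
        - (r₁ Z ^ (j + 2) / (j + 2), Real.sin (t₁ Z)))).trans h
    have h3 := ((Real.hasStrictDerivAt_sin 0).isTheta_sub (by simp)).isBigO_symm
    exact (h3.comp_tendsto (ht.prodMk_nhds ht₁)).trans h1

theorem IsSolution.sub_eval_isBigO {j : ℕ} {R θ : ℝ → ℝ} (h : IsSolution (j + 2) R θ)
    {Rf θf : ℝ⟦X⟧} (hf : IsFormalSolution (j + 2) Rf θf) {m : ℕ} {P Q : Polynomial ℝ}
    (hP : PowerSeries.X ^ (m + 2) ∣ (P : ℝ⟦X⟧) - Rf)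
    (hQ : PowerSeries.X ^ (m + 2) ∣ (Q : ℝ⟦X⟧) - θf) :
    (fun Z => R Z - P.eval Z⁻¹) =O[atTop] (fun Z : ℝ => Z⁻¹ ^ (m + 1)) ∧
    (fun Z => θ Z - Q.eval Z⁻¹) =O[atTop] (fun Z : ℝ => Z⁻¹ ^ (m + 1)) := by
  have hinv : Tendsto (fun Z : ℝ => Z⁻¹) atTop (𝓝 0) := tendsto_inv_atTop_zero
  have hX : ∀ {A : Polynomial ℝ} {p : ℝ⟦X⟧}, PowerSeries.X ^ (m + 2) ∣ (A : ℝ⟦X⟧) - p →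
      Tendsto (fun Z => A.eval Z⁻¹) atTop (𝓝 (PowerSeries.constantCoeff p)) := by
    intro A p hA
    rw [← eval_zero_eq_constantCoeff hA]
    exact (A.continuous.tendsto 0).comp hinv
  have hP1 := hX hP
  have hQ1 := hX hQ
  rw [hf.constantCoeff_R (by omega)] at hP1
  rw [hf.constantCoeff_θ] at hQ1
  have hd : ∀ (A : Polynomial ℝ) {Z : ℝ}, 0 < Z →
      HasDerivAt (fun Z => A.eval Z⁻¹) (-(Z⁻¹ ^ 2 * A.derivative.eval Z⁻¹)) Z := by
    intro A Z hZ
    refine ((A.hasDerivAt Z⁻¹).comp Z (hasDerivAt_inv hZ.ne')).congr_deriv ?_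
    rw [inv_pow]
    ring
  have hbdd : ∀ A : Polynomial ℝ, (fun Z => -(Z⁻¹ ^ 2 * A.derivative.eval Z⁻¹))
      =O[atTop] fun Z : ℝ => Z⁻¹ ^ 2 := by
    intro A
    have h1 := ((A.derivative.continuous.tendsto 0).comp hinv).isBigO_one ℝ
    simpa only [mul_one, Function.comp_def] using
      ((isBigO_refl (fun Z : ℝ => Z⁻¹ ^ 2) atTop).mul h1).neg_left
  obtain ⟨hres1, hres2⟩ := hf.residual_isBigO (by omega) hP hQ
  have hrpow : (fun Z : ℝ => P.eval Z⁻¹ ^ (j + 1)) =O[atTop] fun _ => (1 : ℝ) :=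
    (hP1.pow (j + 1)).isBigO_one ℝ
  have hcos1 : Tendsto (fun Z : ℝ => Real.cos (Q.eval Z⁻¹)) atTop (𝓝 1) := by
    have := (Real.continuous_cos.tendsto 0).comp hQ1
    rwa [Real.cos_zero] at this
  have hcosb := hcos1.isBigO_one ℝ
  refine sub_isBigO_of_canonical h.tendsto_R h.tendsto_θ hP1 hQ1 (j := j) ?_
  refine sub_isBigO_of_perturbed_hamiltonian (V := potential j) (G := dPotential j)
    (x₀ := (1 / (j + 2), 0)) (c := 1) (S := correctionForm j) (J := symplecticJ)
    (ℓ := (j + 2) / 4) (a' := fun Z => (P.eval Z⁻¹ ^ (j + 1) * -(Z⁻¹ ^ 2 * P.derivative.eval Z⁻¹),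
      Real.cos (Q.eval Z⁻¹) * -(Z⁻¹ ^ 2 * Q.derivative.eval Z⁻¹)))
    ?_ (contDiffAt_dPotential j) one_pos (norm_sq_le_fderiv_dPotential j) ?_ apply_symplecticJ
    (by positivity) (tendsto_canonical j h.tendsto_R h.tendsto_θ) (tendsto_canonical j hP1 hQ1)
    ?_ ?_ ?_ ?_
  · have e1 : ∀ᶠ p : ℝ × ℝ in 𝓝 (1 / (j + 2), 0), 0 < p.1 :=
      (continuous_fst.tendsto _).eventually (lt_mem_nhds (by positivity))
    have e2 : ∀ᶠ p : ℝ × ℝ in 𝓝 (1 / ((j : ℝ) + 2), 0), p.2 ^ 2 < 1 :=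
      ((continuous_snd.pow 2).tendsto _).eventually (gt_mem_nhds (by simp))
    filter_upwards [e1, e2] with p h1 h2 using hasFDerivAt_potential j h1 h2
  · intro v w
    rw [correctionForm_apply, correctionForm_apply]
    ring
  · filter_upwards [eventually_gt_atTop 0] with Z hZ
    have hd := hasDerivAt_canonical j (h.deriv_R Z hZ) (h.deriv_θ Z hZ)
    rw [hamiltonian_field_eq j (h.R_pos Z hZ) (h.cos_pos hZ) hZ]
    refine hd.congr_deriv ?_
    push_cast
    ring_nf
  · filter_upwards [eventually_gt_atTop 0] with Z hZ
    exact hasDerivAt_canonical j (hd P hZ) (hd Q hZ)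
  · refine IsBigO.prod_left ?_ ?_
    · simpa only [one_mul] using hrpow.mul (hbdd P)
    · simpa only [one_mul] using hcosb.mul (hbdd Q)
  · have h1 := hrpow.mul (hres1.comp_tendsto hinv)
    have h2 := hcosb.mul (hres2.comp_tendsto hinv)
    simp only [one_mul] at h1 h2
    refine (h1.prod_left h2).congr' ?_ EventuallyEq.rfl
    filter_upwards [eventually_gt_atTop 0, hP1.eventually (lt_mem_nhds one_pos),
      hcos1.eventually (lt_mem_nhds one_pos)] with Z hZ hr hu
    rw [hamiltonian_field_eq j hr hu hZ]
    ext
    · simp only [Prod.fst_sub, Function.comp_apply]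
      field_simp
      ring
    · simp only [Prod.snd_sub, Function.comp_apply]
      push_cast
      field_simp
      ring

theorem sub_sum_isLittleO {f : ℝ → ℝ} {p : ℝ⟦X⟧} {k : ℕ}
    (h : (fun Z => f Z - (PowerSeries.trunc (k + 2) p).eval Z⁻¹)
      =O[atTop] (fun Z : ℝ => Z⁻¹ ^ (k + 1))) :
    (fun Z : ℝ => f Z - ∑ j ∈ Finset.range (k + 1), PowerSeries.coeff j p / Z ^ j)
      =o[atTop] (fun Z : ℝ => 1 / Z ^ k) := by
  have h1 : (fun Z : ℝ => f Z - ∑ j ∈ Finset.range (k + 1), PowerSeries.coeff j p / Z ^ j)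
      =O[atTop] (fun Z : ℝ => Z⁻¹ ^ (k + 1)) := by
    -- The truncation goes one term beyond Z⁻ᵏ, as the energy estimate loses one order against the
    -- residual; the extra term has the size of the error and is discarded.
    have h2 := (isBigO_refl (fun Z : ℝ => Z⁻¹ ^ (k + 1)) atTop).const_mul_left
      (PowerSeries.coeff (k + 1) p)
    refine (h.add h2).congr_left fun Z => ?_
    rw [Polynomial.eval, PowerSeries.eval₂_trunc_eq_sum_range, Finset.sum_range_succ]
    simp only [RingHom.id_apply, inv_pow, div_eq_mul_inv]
    ring
  refine h1.trans_isLittleO ?_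
  have h3 : (fun Z : ℝ => Z⁻¹) =o[atTop] (fun _ => (1 : ℝ)) :=
    (isLittleO_one_iff ℝ).2 tendsto_inv_atTop_zero
  refine ((isBigO_refl (fun Z : ℝ => Z⁻¹ ^ k) atTop).mul_isLittleO h3).congr' ?_ ?_
  · exact Eventually.of_forall fun Z => (pow_succ _ _).symm
  · exact Eventually.of_forall fun Z => by simp

end Asymptotics

end Capillary

end

theorem mainTheorem2 (n : ℕ) (hn : 2 ≤ n) :
    (∃! p : ℝ⟦X⟧ × ℝ⟦X⟧, Capillary.IsFormalSolution n p.1 p.2) ∧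
    ∀ Rf θf : ℝ⟦X⟧, Capillary.IsFormalSolution n Rf θf →
      ∀ R θ : ℝ → ℝ, Capillary.IsSolution n R θ → ∀ k : ℕ,
        (fun Z : ℝ => R Z - ∑ j ∈ Finset.range (k + 1), PowerSeries.coeff j Rf / Z ^ j)
            =o[atTop] (fun Z : ℝ => 1 / Z ^ k) ∧
        (fun Z : ℝ => θ Z - ∑ j ∈ Finset.range (k + 1), PowerSeries.coeff j θf / Z ^ j)
            =o[atTop] (fun Z : ℝ => 1 / Z ^ k) := by
  refine ⟨Capillary.existsUnique_isFormalSolution hn, fun Rf θf hf R θ h k => ?_⟩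
  obtain ⟨j, rfl⟩ : ∃ j, n = j + 2 := ⟨n - 2, by omega⟩
  obtain ⟨h1, h2⟩ := h.sub_eval_isBigO hf (Capillary.X_pow_dvd_trunc_sub Rf (k + 2))
    (Capillary.X_pow_dvd_trunc_sub θf (k + 2))
  exact ⟨Capillary.sub_sum_isLittleO h1, Capillary.sub_sum_isLittleO h2⟩
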